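/- Let $d\ge 1$, and let $g,h:\mathbb R^d\to\mathbb R\cup\{+\infty\}$, where $g\ge 0$ is proper, lower semicontinuous and convex, and $h$ is a Legendre function: proper, lower semicontinuous, strictly convex, differentiable on the interior of its domain, with $\|\nabla h(u_k)\|\to\infty$ along every sequence $(u_k)$ of interior points of $\operatorname{dom}h$ that converges to a boundary point of $\operatorname{dom} h$. Let $\mathcal X=\overline{\operatorname{dom}h}\cap\overline{\operatorname{dom}g}$ have nonempty interior, and assume $\operatorname{int}(\operatorname{dom}h)\cap\operatorname{dom}g\neq\emptyset$. Assume that $h-\frac{\mu_h}{2}\|\cdot\|_2^2$ is convex for some $\mu_h>0$. Let $(x_n,y_n)_{n\ge1}$ be i.i.d. random variables in $\mathbb R^d\times\mathbb R$ with $\mathbb E\|x_n\|_2^2<\infty$ and $\mathbb E y_n^2<\infty$, such that $\Sigma=\mathbb E[x_n\otimes x_n]$ is invertible. Let $f(\theta)=\frac12\mathbb E(\langle x_n,\theta\rangle-y_n)^2$, let $\theta_\Sigma$ be the global minimizer of $f$ on $\mathbb R^d$, and let $\theta_*\in\mathcal X$ be a minimizer of $f+g$ over $\mathcal X$. Write $\|v\|_\Sigma^2=\langle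 v,\Sigma v\rangle$ and $\xi_n=(y_n-\langle\theta_\Sigma,x_n\rangle)x_n$. Assume that there are $\sigma>0$, $\kappa>0$ and $R$ such that $$\mathbb E[\xi_n\otimes\xi_n]\preccurlyeq\sigma^2\Sigma,\qquad \mathbb E\langle z,x_n\rangle^4\le\kappa\langle z,\Sigma z\rangle^2\ \text{ for all } z\in\mathbb R^d,\qquad \mathbb E\big[\|x_n\|_2^2\,x_n\otimes x_n\big]\preccurlyeq R^2\Sigma ,$$ these moments being finite. For $\gamma>0$ put $h_n=h+n\gamma g$, with convex conjugate $h_n^*$, and let $D_h(\alpha,\beta)=h(\alpha)-h(\beta)-\langle\nabla h(\beta),\alpha-\beta\rangle$. Starting from a deterministic point $\theta_0\in\operatorname{int}(\operatorname{dom}h)$ and $\eta_0=\nabla h(\theta_0)$, consider for $n\ge1$ the stochastic dual averaging recursion $$\eta_n=\eta_{n-1}-\gamma\big(\langle x_n,\theta_{n-1}\rangle-y_n\big)x_n,\qquad \theta_n=\nabla h_n^*(\eta_n),$$ and let $\bar\theta_n=\frac1n\sum_{k=0}^{n-1}\theta_k$. If $\gamma\le\min\big\{\frac{\mu_h}{4\kappa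 R^2},\frac{R^2}{4\kappa d}\big\}$, then for every $n\ge1$ the variable $\|\bar\theta_n-\theta_*\|_\Sigma^2$ is integrable and $$\tfrac12\,\mathbb E\|\bar\theta_n-\theta_*\|_\Sigma^2\le \frac{2D_h(\theta_*,\theta_0)}{\gamma n}+\frac8n\Big(3+\frac{4\gamma\kappa R^2}{\mu_h}\Big)\Big(\sigma^2d+\kappa d\|\theta_*-\theta_\Sigma\|_\Sigma^2\Big)+\frac{16\kappa d}{n^2}\Big(\frac{5D_h(\theta_*,\theta_0)}{\gamma}+g(\theta_0)\Big),$$ where the right-hand side is $+\infty$ if $h(\theta_*)=+\infty$ or $g(\theta_0)=+\infty$. -/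

import Mathlib

open MeasureTheory ProbabilityTheory Filter Topology
open scoped Matrix

namespace DualAveraging

/-- The Euclidean space of dimension `d`. -/
abbrev Vec (d : ℕ) : Type := EuclideanSpace ℝ (Fin d)

/-- Effective domain of an extended-real valued function. -/
def effDom {d : ℕ} (φ : Vec d → EReal) : Set (Vec d) := {θ | φ θ ≠ ⊤}

/-- Proper lower semicontinuous convex functions with values in `ℝ ∪ {+∞}`. -/
structure IsProperLscConvex {d : ℕ} (φ : Vec d → EReal) : Prop where
  ne_bot : ∀ θ, φ θ ≠ ⊥
  nonempty_dom : (effDom φ).Nonempty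
  lsc : LowerSemicontinuous φ
  convexOn : ConvexOn ℝ (effDom φ) (fun θ => (φ θ).toReal)

/-- Gradient of an extended-real valued function; meaningful at interior points of the domain
where the function is differentiable. -/
noncomputable def egrad {d : ℕ} (φ : Vec d → EReal) (θ : Vec d) : Vec d :=
  gradient (fun θ' => (φ θ').toReal) θ

/-- Legendre functions: proper, lower semicontinuous, strictly convex, differentiable in the
interior of the domain, with a gradient that diverges at the boundary of the domain. -/
structure IsLegendre {d : ℕ} (h : Vec d → EReal) : Prop where
  proper : IsProperLscConvex h
  strictConvexOn : StrictConvexOn ℝ (effDom h) (fun θ => (h θ).toReal)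
  differentiableAt : ∀ θ ∈ interior (effDom h), DifferentiableAt ℝ (fun θ' => (h θ').toReal) θ
  tendsto_norm_grad : ∀ (u : ℕ → Vec d) (b : Vec d), (∀ k, u k ∈ interior (effDom h)) →
    b ∈ frontier (effDom h) → Tendsto u atTop (𝓝 b) →
      Tendsto (fun k => ‖egrad h (u k)‖) atTop atTop

/-- Convex conjugate `φ* (η) = sup_θ ⟨η, θ⟩ - φ θ`. -/
noncomputable def conj {d : ℕ} (φ : Vec d → EReal) (η : Vec d) : EReal :=
  ⨆ θ : Vec d, (((inner ℝ η θ : ℝ) : EReal) - φ θ)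

/-- Bregman divergence `D_h (α, β) = h α - h β - ⟨∇h β, α - β⟩`, for `β` in the interior of the
domain of `h`. It is `+∞` if `α` is not in the domain of `h`. -/
noncomputable def bregman {d : ℕ} (h : Vec d → EReal) (α β : Vec d) : EReal :=
  h α - h β - ((inner ℝ (egrad h β) (α - β) : ℝ) : EReal)

/-- The function `h_n = h + n γ g`. -/
noncomputable def mirrorReg {d : ℕ} (h g : Vec d → EReal) (γ : ℝ) (n : ℕ) (θ : Vec d) : EReal :=
  h θ + (((n : ℝ) * γ : ℝ) : EReal) * g θ

/-- Stochastic dual averaging for least squares, as the sequence of pairs `(η_n, θ_n)`: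
`η_0 = ∇h θ_0`, `η_n = η_{n-1} - γ (⟨x_n, θ_{n-1}⟩ - y_n) x_n` and `θ_n = ∇h_n^* (η_n)`.
The observation used in step `n + 1` is stored at index `n`. -/
noncomputable def sda {d : ℕ} (h g : Vec d → EReal) (γ : ℝ) (θ₀ : Vec d)
    (x : ℕ → Vec d) (y : ℕ → ℝ) : ℕ → Vec d × Vec d
  | 0 => (egrad h θ₀, θ₀)
  | n + 1 =>
    let η : Vec d := (sda h g γ θ₀ x y n).1
      - γ • ((inner ℝ (x n) (sda h g γ θ₀ x y n).2 - y n) • x n)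
    (η, egrad (conj (mirrorReg h g γ (n + 1))) η)

/-- The average `(1/n) ∑_{k=0}^{n-1} θ_k` of the primal iterates. -/
noncomputable def sdaAverage {d : ℕ} (h g : Vec d → EReal) (γ : ℝ) (θ₀ : Vec d)
    (x : ℕ → Vec d) (y : ℕ → ℝ) (n : ℕ) : Vec d :=
  (n : ℝ)⁻¹ • ∑ k ∈ Finset.range n, (sda h g γ θ₀ x y k).2

/-- The matrix `E[u ⊗ u]`. -/
noncomputable def secondMoment {Ω : Type*} [MeasurableSpace Ω] {d : ℕ} (P : Measure Ω)
    (u : Ω → Vec d) : Matrix (Fin d) (Fin d) ℝ :=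
  Matrix.of fun i j => ∫ ω, u ω i * u ω j ∂P

/-- The squared Mahalanobis norm `‖v‖_A ^ 2 = ⟨v, A v⟩`. -/
noncomputable def mahalSq {d : ℕ} (A : Matrix (Fin d) (Fin d) ℝ) (v : Vec d) : ℝ :=
  inner ℝ v (Matrix.toEuclideanLin A v)

/-- The least-squares risk `θ ↦ (1/2) E (⟨x, θ⟩ - y)^2`. -/
noncomputable def lsRisk {Ω : Type*} [MeasurableSpace Ω] {d : ℕ} (P : Measure Ω)
    (x : Ω → Vec d) (y : Ω → ℝ) (θ : Vec d) : ℝ :=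
  (1 / 2) * ∫ ω, (inner ℝ (x ω) θ - y ω) ^ 2 ∂P

/-- The residual `(y - ⟨θ, x⟩) x` at `θ`. -/
noncomputable def lsResidual {Ω : Type*} {d : ℕ} (x : Ω → Vec d) (y : Ω → ℝ) (θ : Vec d)
    (ω : Ω) : Vec d :=
  (y ω - inner ℝ θ (x ω)) • x ω

end DualAveraging

open DualAveraging

/-!
# Averaged stochastic dual averaging for composite least squares

The stochastic run is compared with the run driven by the exact gradient: their difference is
controlled, after whitening, by the gradient noise, and the noise-free run by the dual gap.
-/

/-! Write p for `θopt`, c for `θS`, and e_k for the gradient noise, that is, the exact gradient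
S(θ_k - c) minus its sample. Strong convexity makes θ_k the minimizer of h_k - ⟨η_k, ·⟩ with
quadratic growth μ/2, so at each stage the map from η to θ is strongly monotone and 1/μ-Lipschitz.
Given the past, e_k is centred.

The stochastic run is coupled with the noise-free run (ν_k, φ_k) from the same starting point. Since
the gradient is affine, W_k = η_k - ν_k satisfies W_{k+1} = W_k - γS(θ_k - φ_k) + γe_k, and summing
gives γS Σ_{k<n}(θ_k - φ_k) = γ Σ_{k<n} e_k - W_n. Dual vectors are measured through a whitening B
with B*B = S⁻¹, so that ‖v‖_S = ‖BSv‖. In this norm the drift W_k ↦ W_k - γS(θ_k - φ_k) does not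
increase the length: the cross term is -2γ⟨W_k, θ_k - φ_k⟩ ≤ -2γμ‖θ_k - φ_k‖², which dominates
γ²‖θ_k - φ_k‖_S². Orthogonality of the noise then bounds both terms on the right, and E‖Σ(θ_k -
φ_k)‖_S² ≤ 4 Σ E‖Be_k‖². This is `IsDualPath.integral_mahalSq_sum_sub_le`; dividing by n² yields the
1/n rate.

By the kurtosis condition, E‖Be_k‖² is at most affine in E‖θ_k - p‖_S². The sum of these errors only
has to be O(n), which follows from a Lyapunov argument with the Fenchel gap h_k(p) + h_k*(η_k) -
⟨η_k, p⟩ (`dualGap_succ_le`, `IsDualPath.sum_integral_mahalSq_le`). The same argument without noise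
gives Σ‖φ_k - p‖_S² ≤ 2D/γ, where D is the initial gap, equal to the Bregman divergence.
`IsDualPath.half_integral_mahalSq_average_le` combines these estimates. -/

namespace DualAveraging

/-! ### Minimizers with quadratic growth. -/

variable {d : ℕ}

/-- `θ` minimizes `F - ⟨η, ·⟩` over `C`, with quadratic growth of modulus `μ`. -/
structure IsStrongMin (μ : ℝ) (C : Set (Vec d)) (F : Vec d → ℝ) (η θ : Vec d) : Prop where
  mem : θ ∈ C
  le : ∀ z ∈ C, F θ - inner ℝ η θ + μ / 2 * ‖z - θ‖ ^ 2 ≤ F z - inner ℝ η z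

/-- A lower bound on the slopes of `F` at `θ` towards `z` gives a lower bound on `F z`, improved by
strong convexity. -/
lemma StrongConvexOn.le_of_tendsto_slope {C : Set (Vec d)} {F : Vec d → ℝ} {μ a : ℝ}
    (hF : StrongConvexOn C μ F) {θ z : Vec d} (hθ : θ ∈ C) (hz : z ∈ C) {s : ℝ → ℝ}
    (hs : Tendsto s (𝓝[>] 0) (𝓝 a))
    (hsF : ∀ t ∈ Set.Ioo (0 : ℝ) 1, s t ≤ t⁻¹ * (F (θ + t • (z - θ)) - F θ)) :
    F θ + a + μ / 2 * ‖z - θ‖ ^ 2 ≤ F z := by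
  have key : ∀ t ∈ Set.Ioo (0 : ℝ) 1,
      s t ≤ F z - F θ - (1 - t) * (μ / 2 * ‖z - θ‖ ^ 2) := by
    intro t ht
    refine (hsF t ht).trans ?_
    have h1 := hF.2 hz hθ ht.1.le (sub_nonneg.2 ht.2.le) (by ring)
    have e : t • z + (1 - t) • θ = θ + t • (z - θ) := by module
    rw [e] at h1
    simp only [smul_eq_mul] at h1
    rw [inv_mul_le_iff₀ ht.1]
    linarith
  have hlim : Tendsto (fun t : ℝ => F z - F θ - (1 - t) * (μ / 2 * ‖z - θ‖ ^ 2)) (𝓝[>] 0)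
      (𝓝 (F z - F θ - (1 - 0) * (μ / 2 * ‖z - θ‖ ^ 2))) := by
    apply Tendsto.mono_left _ nhdsWithin_le_nhds
    exact Continuous.tendsto (by fun_prop) 0
  have := le_of_tendsto_of_tendsto hs hlim
    (by filter_upwards [Ioo_mem_nhdsGT (zero_lt_one' ℝ)] with t ht using key t ht)
  linarith

lemma StrongConvexOn.isStrongMin {C : Set (Vec d)} {F : Vec d → ℝ} {μ : ℝ}
    (hF : StrongConvexOn C μ F) {η θ : Vec d} (hθ : θ ∈ C)
    (hmin : ∀ z ∈ C, F θ - inner ℝ η θ ≤ F z - inner ℝ η z) : IsStrongMin μ C F η θ := by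
  refine ⟨hθ, fun z hz => ?_⟩
  have := StrongConvexOn.le_of_tendsto_slope hF hθ hz (a := inner ℝ η (z - θ))
    (s := fun _ => inner ℝ η (z - θ)) tendsto_const_nhds (by
      intro t ht
      have hm : θ + t • (z - θ) ∈ C := by
        have := hF.1 hz hθ ht.1.le (sub_nonneg.2 ht.2.le) (by ring)
        have e : t • z + (1 - t) • θ = θ + t • (z - θ) := by module
        rwa [e] at this
      have := hmin _ hm
      rw [le_inv_mul_iff₀ ht.1]
      rw [inner_add_right, inner_smul_right] at this
      linarith)
  rw [inner_sub_right] at this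
  linarith

lemma StrongConvexOn.isStrongMin_gradient {C : Set (Vec d)} {F : Vec d → ℝ} {μ : ℝ}
    (hF : StrongConvexOn C μ F) {θ : Vec d} (hθ : θ ∈ C) (hd : DifferentiableAt ℝ F θ) :
    IsStrongMin μ C F (gradient F θ) θ := by
  refine ⟨hθ, fun z hz => ?_⟩
  have h1 : HasDerivAt (fun t : ℝ => F (θ + t • (z - θ))) (inner ℝ (gradient F θ) (z - θ)) 0 := by
    have hg := hd.hasGradientAt.hasFDerivAt
    have hl : HasDerivAt (fun t : ℝ => θ + t • (z - θ)) (z - θ) 0 := by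
      simpa using ((hasDerivAt_id (0 : ℝ)).smul_const (z - θ)).const_add θ
    have := HasFDerivAt.comp_hasDerivAt (x := (0 : ℝ)) (l := F)
      (f := fun t : ℝ => θ + t • (z - θ)) (by rw [zero_smul, add_zero]; exact hg) hl
    rw [InnerProductSpace.toDual_apply_apply] at this
    exact this
  have h2 := (hasDerivAt_iff_tendsto_slope.1 h1).mono_left
    (nhdsWithin_mono (0 : ℝ) (s := Set.Ioi 0) (fun t ht => ne_of_gt ht))
  have := StrongConvexOn.le_of_tendsto_slope hF hθ hz h2 (by
    intro t ht
    simp [slope_def_field, div_eq_inv_mul])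
  rw [inner_sub_right] at this
  linarith

/-- Each minimizer competes in the other problem; adding the two inequalities cancels F and doubles
the growth term. -/
lemma IsStrongMin.mono_inner {C : Set (Vec d)} {F : Vec d → ℝ} {μ : ℝ} {η θ ω φ : Vec d}
    (h1 : IsStrongMin μ C F η θ) (h2 : IsStrongMin μ C F ω φ) :
    μ * ‖θ - φ‖ ^ 2 ≤ inner ℝ (η - ω) (θ - φ) := by
  have a := h1.le φ h2.mem
  have b := h2.le θ h1.mem
  rw [norm_sub_rev φ θ] at a
  simp only [inner_sub_left, inner_sub_right]
  linarith

lemma IsStrongMin.norm_sub_le {C : Set (Vec d)} {F : Vec d → ℝ} {μ : ℝ} (hμ : 0 < μ)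
    {η θ ω φ : Vec d}
    (h1 : IsStrongMin μ C F η θ) (h2 : IsStrongMin μ C F ω φ) :
    ‖θ - φ‖ ≤ μ⁻¹ * ‖η - ω‖ := by
  have a := (h1.mono_inner h2).trans (real_inner_le_norm _ _)
  rw [le_inv_mul_iff₀ hμ]
  rcases eq_or_lt_of_le (norm_nonneg (θ - φ)) with h | h
  · rw [← h]; simp
  · nlinarith

/-! ### The stage regularizers and the gradient of their conjugates. -/

/-- The real-valued regularizer of stage `k`. -/
noncomputable def stageFun (h g : Vec d → EReal) (γ : ℝ) (k : ℕ) (z : Vec d) : ℝ :=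
  (h z).toReal + k * γ * (g z).toReal

/-- The domain of the regularizer of stage `k`. -/
def stageDom (h g : Vec d → EReal) : ℕ → Set (Vec d)
  | 0 => effDom h
  | _ + 1 => effDom h ∩ effDom g

lemma IsProperLscConvex.coe_toReal {φ : Vec d → EReal} (hφ : IsProperLscConvex φ) {z : Vec d}
    (hz : z ∈ effDom φ) : (((φ z).toReal : ℝ) : EReal) = φ z :=
  EReal.coe_toReal hz (hφ.ne_bot z)

lemma strongConvexOn_stageFun {h g : Vec d → EReal} (hg : IsProperLscConvex g)
    {μ γ : ℝ} (hγ : 0 < γ)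
    (hstrong : ConvexOn ℝ (effDom h) (fun θ => (h θ).toReal - μ / 2 * ‖θ‖ ^ 2)) (k : ℕ) :
    StrongConvexOn (effDom h ∩ effDom g) μ (stageFun h g γ k) := by
  rw [strongConvexOn_iff_convex]
  have hC := hstrong.1.inter hg.convexOn.1
  have h1 := hstrong.subset Set.inter_subset_left hC
  have h2 := (hg.convexOn.subset Set.inter_subset_right hC).smul (c := k * γ) (by positivity)
  have := h1.add h2
  refine this.congr fun z _ => ?_
  simp only [Pi.add_apply, smul_eq_mul, stageFun]
  ring

lemma mirrorReg_eq_coe {h g : Vec d → EReal} (hh : IsProperLscConvex h)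
    (hg : IsProperLscConvex g) (γ : ℝ) (k : ℕ) {z : Vec d} (hz : z ∈ effDom h ∩ effDom g) :
    mirrorReg h g γ k z = (stageFun h g γ k z : ℝ) := by
  rw [mirrorReg, ← hh.coe_toReal hz.1, ← hg.coe_toReal hz.2, stageFun]
  norm_cast

/-- Stated from stage one on: at stage zero the coefficient of g vanishes and 0 * ⊤ = 0 in `EReal`,
so points outside the domain of g stay admissible there. -/
lemma mirrorReg_eq_top {h g : Vec d → EReal} (hh : IsProperLscConvex h)
    (hg0 : ∀ z, 0 ≤ g z) {γ : ℝ} (hγ : 0 < γ) (k : ℕ) {z : Vec d}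
    (hz : z ∉ effDom h ∩ effDom g) : mirrorReg h g γ (k + 1) z = ⊤ := by
  have hc : 0 < ((k + 1 : ℕ) : ℝ) * γ := by positivity
  have h1 : mirrorReg h g γ (k + 1) z = h z + ((((k + 1 : ℕ) : ℝ) * γ : ℝ) : EReal) * g z := rfl
  rw [h1]
  by_cases hz1 : h z = ⊤
  · rw [hz1]
    apply EReal.top_add_of_ne_bot
    apply ne_of_gt
    exact lt_of_lt_of_le EReal.bot_lt_zero (mul_nonneg (by exact_mod_cast hc.le) (hg0 z))
  · have hz2 : g z = ⊤ := by
      by_contra hne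
      exact hz ⟨hz1, hne⟩
    rw [hz2, EReal.coe_mul_top_of_pos hc]
    exact EReal.add_top_of_ne_bot (hh.ne_bot z)

lemma lowerSemicontinuous_mirrorReg {h g : Vec d → EReal} (hh : IsProperLscConvex h)
    (hg : IsProperLscConvex g) (hg0 : ∀ z, 0 ≤ g z) {γ : ℝ} (hγ : 0 < γ) (k : ℕ) :
    LowerSemicontinuous (mirrorReg h g γ (k + 1)) := by
  have hc : 0 < ((k + 1 : ℕ) : ℝ) * γ := by positivity
  have h1 : LowerSemicontinuous (fun z => ((((k + 1 : ℕ) : ℝ) * γ : ℝ) : EReal) * g z) := by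
    refine Continuous.comp_lowerSemicontinuous
      (g := fun a : EReal => ((((k + 1 : ℕ) : ℝ) * γ : ℝ) : EReal) * a) ?_ hg.lsc ?_
    · have hc' : ((((k + 1 : ℕ) : ℝ) * γ : ℝ) : EReal) ≠ 0 := by exact_mod_cast hc.ne'
      refine continuous_iff_continuousAt.2 fun a => ?_
      exact ContinuousAt.comp (f := fun a : EReal => (((((k + 1 : ℕ) : ℝ) * γ : ℝ) : EReal), a))
        (EReal.continuousAt_mul (.inl hc') (.inl hc') (.inl (EReal.coe_ne_bot _))
        (.inl (EReal.coe_ne_top _))) (by fun_prop)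
    · intro a b hab
      exact mul_le_mul_of_nonneg_left hab (by exact_mod_cast hc.le)
  refine hh.lsc.add' h1 fun z => ?_
  apply EReal.continuousAt_add
  · right
    apply ne_of_gt
    exact lt_of_lt_of_le EReal.bot_lt_zero (mul_nonneg (by exact_mod_cast hc.le) (hg0 z))
  · left
    exact hh.ne_bot z

/-- The objective is coercive because g is nonnegative and h grows quadratically around a point p
where it has a gradient. Lower semicontinuity on a closed ball then gives a minimizer. -/
theorem exists_isStrongMin {h g : Vec d → EReal} (hh : IsLegendre h)
    (hg : IsProperLscConvex g) (hg0 : ∀ z, 0 ≤ g z)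
    (hdom : (interior (effDom h) ∩ effDom g).Nonempty) {μ γ : ℝ} (hμ : 0 < μ) (hγ : 0 < γ)
    (hstrong : ConvexOn ℝ (effDom h) (fun θ => (h θ).toReal - μ / 2 * ‖θ‖ ^ 2)) (k : ℕ)
    (η : Vec d) :
    ∃ θ, IsStrongMin μ (effDom h ∩ effDom g) (stageFun h g γ (k + 1)) η θ := by
  obtain ⟨p, hp1, hp2⟩ := hdom
  have hpC : p ∈ effDom h ∩ effDom g := ⟨interior_subset hp1, hp2⟩
  set F := stageFun h g γ (k + 1) with hFdef
  have hlow := (StrongConvexOn.isStrongMin_gradient (strongConvexOn_iff_convex.2 hstrong)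
    hpC.1 (hh.differentiableAt p hp1)).le
  set v := gradient (fun θ => (h θ).toReal) p with hv
  set m := |F p - (h p).toReal| with hm
  -- Beyond this radius the growth μ/2‖z - p‖² beats the linear term ⟨v - η, z - p⟩ and the offset F
  -- p - h p; the last summand ensures r ≥ 1.
  set r := 2 / μ * (‖v - η‖ + m + 1) + 1 with hr
  have hm0 : 0 ≤ m := abs_nonneg _
  have hr1 : 1 ≤ r := by
    have : 0 ≤ 2 / μ * (‖v - η‖ + m + 1) := by positivity
    linarith
  have hGnn : ∀ z, 0 ≤ (g z).toReal := fun z => EReal.toReal_nonneg (hg0 z)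
  have hout : ∀ z ∈ effDom h ∩ effDom g, r ≤ ‖z - p‖ →
      F p - inner ℝ η p ≤ F z - inner ℝ η z := by
    intro z hz hzr
    have a := hlow z hz.1
    have b : (h z).toReal ≤ F z := by
      rw [hFdef, stageFun]
      have := hGnn z
      have : 0 ≤ ((k + 1 : ℕ) : ℝ) * γ * (g z).toReal := by positivity
      linarith
    have c := neg_le_of_abs_le (abs_real_inner_le_norm (v - η) (z - p))
    simp only [inner_sub_left, inner_sub_right] at c
    have e : F p - (h p).toReal ≤ m := le_abs_self _
    have f1 : ‖v - η‖ + m + 1 ≤ μ / 2 * ‖z - p‖ := by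
      have : 2 / μ * (‖v - η‖ + m + 1) ≤ ‖z - p‖ := by linarith
      calc ‖v - η‖ + m + 1 = μ / 2 * (2 / μ * (‖v - η‖ + m + 1)) := by field_simp
        _ ≤ _ := by gcongr
    have f2 : (‖v - η‖ + m + 1) * ‖z - p‖ ≤ μ / 2 * ‖z - p‖ ^ 2 := by
      have := mul_le_mul_of_nonneg_right f1 (norm_nonneg (z - p))
      linarith
    have f3 : m + 1 ≤ (m + 1) * ‖z - p‖ := by nlinarith
    nlinarith
  have hlsc : LowerSemicontinuous
      (fun z => mirrorReg h g γ (k + 1) z + ((-inner ℝ η z : ℝ) : EReal)) := by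
    refine (lowerSemicontinuous_mirrorReg hh.proper hg hg0 hγ k).add'
      (Continuous.lowerSemicontinuous ?_) fun z => ?_
    · exact continuous_coe_real_ereal.comp (by fun_prop)
    · apply EReal.continuousAt_add
      · right; exact EReal.coe_ne_bot _
      · right; exact EReal.coe_ne_top _
  obtain ⟨θ, hθb, hθ⟩ := (hlsc.lowerSemicontinuousOn (Metric.closedBall p r)).exists_isMinOn
    ⟨p, Metric.mem_closedBall_self (by linarith)⟩ (isCompact_closedBall p r)
  have hval : ∀ z ∈ effDom h ∩ effDom g,
      mirrorReg h g γ (k + 1) z + ((-inner ℝ η z : ℝ) : EReal)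
        = ((F z - inner ℝ η z : ℝ) : EReal) := by
    intro z hz
    rw [mirrorReg_eq_coe hh.proper hg γ (k + 1) hz, ← EReal.coe_add, sub_eq_add_neg]
  have hθp := hθ (Metric.mem_closedBall_self (by linarith) : p ∈ Metric.closedBall p r)
  have hθC : θ ∈ effDom h ∩ effDom g := by
    by_contra hne
    simp only [Set.mem_ofPred_eq] at hθp
    rw [hval p hpC, mirrorReg_eq_top hh.proper hg0 hγ k hne, EReal.top_add_coe, top_le_iff] at hθp
    exact EReal.coe_ne_top _ hθp
  refine ⟨θ, StrongConvexOn.isStrongMin (strongConvexOn_stageFun hg hγ hstrong (k + 1)) hθC ?_⟩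
  intro z hz
  have hin : ∀ z ∈ effDom h ∩ effDom g, z ∈ Metric.closedBall p r →
      F θ - inner ℝ η θ ≤ F z - inner ℝ η z := by
    intro z hz hzb
    have := hθ hzb
    simp only [Set.mem_ofPred_eq] at this
    rw [hval z hz, hval θ hθC] at this
    exact_mod_cast this
  by_cases hzb : z ∈ Metric.closedBall p r
  · exact hin z hz hzb
  · refine (hin p hpC (Metric.mem_closedBall_self (by linarith))).trans (hout z hz ?_)
    rw [Metric.mem_closedBall, dist_eq_norm] at hzb
    exact (not_le.1 hzb).le

lemma IsStrongMin.conj_eq {h g : Vec d → EReal} (hh : IsProperLscConvex h)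
    (hg : IsProperLscConvex g) (hg0 : ∀ z, 0 ≤ g z) {μ γ : ℝ} (hμ : 0 < μ) (hγ : 0 < γ) {k : ℕ}
    {η θ : Vec d} (hθ : IsStrongMin μ (effDom h ∩ effDom g) (stageFun h g γ (k + 1)) η θ) :
    conj (mirrorReg h g γ (k + 1)) η
      = ((inner ℝ η θ - stageFun h g γ (k + 1) θ : ℝ) : EReal) := by
  apply le_antisymm
  · refine iSup_le fun z => ?_
    by_cases hz : z ∈ effDom h ∩ effDom g
    · rw [mirrorReg_eq_coe hh hg γ (k + 1) hz, ← EReal.coe_sub, EReal.coe_le_coe_iff]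
      have := hθ.le z hz
      have : 0 ≤ μ / 2 * ‖z - θ‖ ^ 2 := by positivity
      linarith
    · rw [mirrorReg_eq_top hh hg0 hγ k hz, EReal.sub_top]
      exact bot_le
  · refine le_trans (le_of_eq ?_) (le_iSup _ θ)
    rw [mirrorReg_eq_coe hh hg γ (k + 1) hθ.mem, ← EReal.coe_sub]

/-- Let T η be the minimizer. Testing minimality at η and at ζ traps the remainder conj ζ - conj η -
⟨T η, ζ - η⟩ between 0 and ⟨ζ - η, T ζ - T η⟩, which is at most ‖ζ - η‖²/μ. Hence the conjugate is
differentiable with gradient T η. -/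
theorem isStrongMin_egrad_conj {h g : Vec d → EReal} (hh : IsLegendre h)
    (hg : IsProperLscConvex g) (hg0 : ∀ z, 0 ≤ g z)
    (hdom : (interior (effDom h) ∩ effDom g).Nonempty) {μ γ : ℝ} (hμ : 0 < μ) (hγ : 0 < γ)
    (hstrong : ConvexOn ℝ (effDom h) (fun θ => (h θ).toReal - μ / 2 * ‖θ‖ ^ 2)) (k : ℕ)
    (η : Vec d) :
    IsStrongMin μ (effDom h ∩ effDom g) (stageFun h g γ (k + 1)) η
      (egrad (conj (mirrorReg h g γ (k + 1))) η) := by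
  choose T hT using exists_isStrongMin hh hg hg0 hdom hμ hγ hstrong k
  suffices hgrad : HasGradientAt (fun η' => (conj (mirrorReg h g γ (k + 1)) η').toReal) (T η) η by
    rw [egrad, hgrad.gradient]
    exact hT η
  have hval : ∀ ζ, (conj (mirrorReg h g γ (k + 1)) ζ).toReal
      = inner ℝ ζ (T ζ) - stageFun h g γ (k + 1) (T ζ) := fun ζ => by
    rw [(hT ζ).conj_eq hh.proper hg hg0 hμ hγ, EReal.toReal_coe]
  rw [hasGradientAt_iff_isLittleO]
  refine Asymptotics.IsBigO.trans_isLittleO (g := fun ζ => ‖ζ - η‖ ^ 2) ?_ ?_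
  · refine Asymptotics.IsBigO.of_bound μ⁻¹ (Eventually.of_forall fun ζ => ?_)
    rw [hval, hval]
    have a := (hT η).le _ (hT ζ).mem
    have b := (hT ζ).le _ (hT η).mem
    have a0 : 0 ≤ μ / 2 * ‖T ζ - T η‖ ^ 2 := by positivity
    have b0 : 0 ≤ μ / 2 * ‖T η - T ζ‖ ^ 2 := by positivity
    have c : inner ℝ (ζ - η) (T ζ - T η) ≤ μ⁻¹ * ‖ζ - η‖ ^ 2 := by
      refine (real_inner_le_norm _ _).trans ?_
      have := mul_le_mul_of_nonneg_left ((hT ζ).norm_sub_le hμ (hT η)) (norm_nonneg (ζ - η))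
      linarith
    rw [Real.norm_eq_abs, abs_le, Real.norm_of_nonneg (by positivity)]
    simp only [inner_sub_left, inner_sub_right, real_inner_comm] at *
    constructor <;> linarith
  · have := Asymptotics.isLittleO_norm_pow_id (E' := Vec d) (n := 2) (by norm_num)
    exact this.comp_tendsto (k := fun ζ => ζ - η) (by
      have : Tendsto (fun ζ : Vec d => ζ - η) (𝓝 η) (𝓝 (η - η)) :=
        Continuous.tendsto (by fun_prop) η
      simpa using this)

end DualAveraging

/-! ### The dual gap as a Lyapunov function. -/

namespace DualAveraging

variable {d : ℕ}

lemma stageDom_succ_subset (h g : Vec d → EReal) (k : ℕ) :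
    stageDom h g (k + 1) ⊆ stageDom h g k := by
  cases k with
  | zero => exact Set.inter_subset_left
  | succ k => exact subset_rfl

lemma inter_subset_stageDom (h g : Vec d → EReal) (k : ℕ) :
    effDom h ∩ effDom g ⊆ stageDom h g k := by
  cases k with
  | zero => exact Set.inter_subset_left
  | succ k => exact subset_rfl

lemma stageFun_succ (h g : Vec d → EReal) (γ : ℝ) (k : ℕ) (z : Vec d) :
    stageFun h g γ (k + 1) z = stageFun h g γ k z + γ * (g z).toReal := by
  simp only [stageFun]
  push_cast
  ring

/-- The variational inequality at a minimizer `p` of the sum of a quadratic function and `g`. -/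
lemma IsProperLscConvex.first_order {g : Vec d → EReal} (hg : IsProperLscConvex g)
    {X : Set (Vec d)} (hX : Convex ℝ X) {f : Vec d → ℝ} {w p : Vec d} {q : Vec d → ℝ}
    (hq : ∀ (t : ℝ) v, q (t • v) = t ^ 2 * q v)
    (hf : ∀ z, f z = f p + inner ℝ w (z - p) + 1 / 2 * q (z - p)) (hpX : p ∈ X)
    (hpg : p ∈ effDom g) (hmin : ∀ z ∈ X, (f p : EReal) + g p ≤ (f z : EReal) + g z)
    {z : Vec d} (hz : z ∈ X) (hzg : z ∈ effDom g) :
    0 ≤ inner ℝ w (z - p) + (g z).toReal - (g p).toReal := by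
  -- Convexity bounds the increment of g along the segment linearly in t, while the quadratic part
  -- of f is of order t² and disappears after division by t and t → 0.
  have key : ∀ t ∈ Set.Ioo (0 : ℝ) 1,
      0 ≤ inner ℝ w (z - p) + (g z).toReal - (g p).toReal + t * (1 / 2 * q (z - p)) := by
    intro t ht
    have e : t • z + (1 - t) • p = p + t • (z - p) := by module
    have hmX := hX hz hpX ht.1.le (sub_nonneg.2 ht.2.le) (by ring)
    have hmg := hg.convexOn.1 hzg hpg ht.1.le (sub_nonneg.2 ht.2.le) (by ring)
    have hc := hg.convexOn.2 hzg hpg ht.1.le (sub_nonneg.2 ht.2.le) (by ring)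
    rw [e] at hmX hmg hc
    have h1 := hmin _ hmX
    rw [← hg.coe_toReal hmg, ← hg.coe_toReal hpg, ← EReal.coe_add, ← EReal.coe_add,
      EReal.coe_le_coe_iff, hf (p + t • (z - p)), add_sub_cancel_left, hq, inner_smul_right] at h1
    simp only [smul_eq_mul] at hc
    have : 0 ≤ t * (inner ℝ w (z - p) + (g z).toReal - (g p).toReal
        + t * (1 / 2 * q (z - p))) := by nlinarith
    exact nonneg_of_mul_nonneg_right this ht.1
  have hlim : Tendsto (fun t : ℝ => inner ℝ w (z - p) + (g z).toReal - (g p).toReal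
      + t * (1 / 2 * q (z - p))) (𝓝[>] 0)
      (𝓝 (inner ℝ w (z - p) + (g z).toReal - (g p).toReal + 0 * (1 / 2 * q (z - p)))) :=
    Tendsto.mono_left (Continuous.tendsto (by fun_prop) 0) nhdsWithin_le_nhds
  have := ge_of_tendsto hlim
    (by filter_upwards [Ioo_mem_nhdsGT (zero_lt_one' ℝ)] with t ht using key t ht)
  linarith

/-- Expansion of the quadratic form of a symmetric map at a difference. -/
lemma LinearMap.IsSymmetric.inner_sub_sub {L : Vec d →ₗ[ℝ] Vec d} (hL : L.IsSymmetric)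
    (a b : Vec d) :
    inner ℝ (b - a) (L (b - a)) = inner ℝ a (L a) + inner ℝ b (L b) - 2 * inner ℝ (L a) b := by
  have h1 : inner ℝ b (L a) = inner ℝ (L a) b := real_inner_comm _ _
  have h2 : inner ℝ a (L b) = inner ℝ (L a) b := (hL a b).symm
  rw [map_sub, inner_sub_left, inner_sub_right, inner_sub_right, h1, h2]
  ring

/-- The gap between `p` and the minimizer `θ` of `F - ⟨η, ·⟩`. -/
noncomputable def dualGap (F : Vec d → ℝ) (p η θ : Vec d) : ℝ :=
  F p - inner ℝ η p - (F θ - inner ℝ η θ)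

lemma IsStrongMin.dualGap_nonneg {C : Set (Vec d)} {F : Vec d → ℝ} {μ : ℝ} (hμ : 0 ≤ μ)
    {η θ p : Vec d} (h : IsStrongMin μ C F η θ) (hp : p ∈ C) : 0 ≤ dualGap F p η θ := by
  have := h.le p hp
  have : 0 ≤ μ / 2 * ‖p - θ‖ ^ 2 := by positivity
  rw [dualGap]
  linarith

/-- One step of dual averaging for the least-squares objective, with noise `e`. -/
lemma dualGap_succ_le {h g : Vec d → EReal} {μ γ : ℝ} (hμ : 0 < μ) (hγ : 0 < γ)
    {L : Vec d →ₗ[ℝ] Vec d} (hL : L.IsSymmetric)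
    (hLμ : ∀ v, γ * inner ℝ v (L v) ≤ μ / 4 * ‖v‖ ^ 2) {p c : Vec d}
    (hopt : ∀ z ∈ effDom h ∩ effDom g,
      0 ≤ inner ℝ (L (p - c)) (z - p) + (g z).toReal - (g p).toReal)
    {k : ℕ} {η θ η' θ' e : Vec d}
    (hθ : IsStrongMin μ (stageDom h g k) (stageFun h g γ k) η θ)
    (hθ' : IsStrongMin μ (stageDom h g (k + 1)) (stageFun h g γ (k + 1)) η' θ')
    (hη : η' = η - γ • (L (θ - c) - e)) :
    dualGap (stageFun h g γ (k + 1)) p η' θ' + γ / 2 * inner ℝ (θ - p) (L (θ - p))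
        + γ / 2 * inner ℝ (θ' - p) (L (θ' - p))
      ≤ dualGap (stageFun h g γ k) p η θ
        + (γ * inner ℝ e (θ - p) + 2 / 3 * γ ^ 2 / μ * ‖e‖ ^ 2) := by
  -- Testing stage k at θ' gains μ/2‖θ' - θ‖². Of this, μ/8 pays for the term γ/2⟨θ' - θ, L(θ' - θ)⟩
  -- left by polarization, and the remaining 3μ/8 pays for the noise in `h6`; this fixes the
  -- constant 2/3.
  have h1 := hθ.le θ' (stageDom_succ_subset h g k hθ'.mem)
  have h2 := hopt θ' hθ'.mem
  -- Polarization turns ⟨L(θ - p), θ' - p⟩ into half the squared errors at both θ and θ'. The first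
  -- half later absorbs the part of the noise that grows with the error; the second is kept.
  have h3 := LinearMap.IsSymmetric.inner_sub_sub hL (θ - p) (θ' - p)
  have h4 := hLμ (θ' - θ)
  rw [sub_sub_sub_cancel_right] at h3
  have h5 : inner ℝ (L (θ - c)) (θ' - p)
      = inner ℝ (L (θ - p)) (θ' - p) + inner ℝ (L (p - c)) (θ' - p) := by
    rw [← inner_add_left, ← map_add, sub_add_sub_cancel]
  have h6 : γ * inner ℝ e (θ' - θ)
      ≤ 2 / 3 * γ ^ 2 / μ * ‖e‖ ^ 2 + 3 / 8 * μ * ‖θ' - θ‖ ^ 2 := by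
    have a := real_inner_le_norm e (θ' - θ)
    have b : 0 ≤ (2 / 3 * γ * ‖e‖ - 1 / 2 * μ * ‖θ' - θ‖) ^ 2 := sq_nonneg _
    have c : 2 / 3 * γ ^ 2 / μ * ‖e‖ ^ 2 + 3 / 8 * μ * ‖θ' - θ‖ ^ 2 - γ * (‖e‖ * ‖θ' - θ‖)
        = 3 / (2 * μ) * (2 / 3 * γ * ‖e‖ - 1 / 2 * μ * ‖θ' - θ‖) ^ 2 := by
      field_simp
      ring
    have e1 : 0 ≤ 3 / (2 * μ) * (2 / 3 * γ * ‖e‖ - 1 / 2 * μ * ‖θ' - θ‖) ^ 2 := by positivity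
    have := mul_le_mul_of_nonneg_left a hγ.le
    linarith
  have h7 : inner ℝ e (θ' - θ) = inner ℝ e (θ' - p) - inner ℝ e (θ - p) := by
    rw [← inner_sub_right, sub_sub_sub_cancel_right]
  have h8 : inner ℝ (η' - η) (θ' - p)
      = -(γ * inner ℝ (L (θ - c)) (θ' - p)) + γ * inner ℝ e (θ' - p) := by
    rw [hη, sub_sub_cancel_left, inner_neg_left, inner_smul_left, inner_sub_left]
    simp only [conj_trivial]
    ring
  rw [h5] at h8
  rw [h7] at h6
  simp only [inner_sub_left η' η, inner_sub_right η' θ' p, inner_sub_right η θ' p] at h8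
  rw [dualGap, dualGap, stageFun_succ, stageFun_succ]
  have h9 := mul_nonneg hγ.le h2
  have h10 : γ * inner ℝ (L (θ - p)) (θ' - p) = γ / 2 * (inner ℝ (θ - p) (L (θ - p))
      + inner ℝ (θ' - p) (L (θ' - p)) - inner ℝ (θ' - θ) (L (θ' - θ))) := by
    rw [h3]; ring
  rw [mul_add] at h8
  rw [h10] at h8
  linarith

/-- The one-step inequality telescopes, and the last gap is nonnegative because p is admissible at
every stage. -/
theorem sum_dualAveraging_le {h g : Vec d → EReal} {μ γ : ℝ} (hμ : 0 < μ) (hγ : 0 < γ)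
    {L : Vec d →ₗ[ℝ] Vec d} (hL : L.IsSymmetric)
    (hLμ : ∀ v, γ * inner ℝ v (L v) ≤ μ / 4 * ‖v‖ ^ 2) {p c : Vec d}
    (hp : p ∈ effDom h ∩ effDom g)
    (hopt : ∀ z ∈ effDom h ∩ effDom g,
      0 ≤ inner ℝ (L (p - c)) (z - p) + (g z).toReal - (g p).toReal)
    {η θ e : ℕ → Vec d}
    (hθ : ∀ k, IsStrongMin μ (stageDom h g k) (stageFun h g γ k) (η k) (θ k))
    (hη : ∀ k, η (k + 1) = η k - γ • (L (θ k - c) - e k)) (n : ℕ) :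
    ∑ k ∈ Finset.range n, (γ / 2 * inner ℝ (θ k - p) (L (θ k - p))
        + γ / 2 * inner ℝ (θ (k + 1) - p) (L (θ (k + 1) - p)))
      ≤ dualGap (stageFun h g γ 0) p (η 0) (θ 0)
        + ∑ k ∈ Finset.range n,
          (γ * inner ℝ (e k) (θ k - p) + 2 / 3 * γ ^ 2 / μ * ‖e k‖ ^ 2) := by
  have key : ∀ n, dualGap (stageFun h g γ n) p (η n) (θ n)
      + ∑ k ∈ Finset.range n, (γ / 2 * inner ℝ (θ k - p) (L (θ k - p))
        + γ / 2 * inner ℝ (θ (k + 1) - p) (L (θ (k + 1) - p)))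
      ≤ dualGap (stageFun h g γ 0) p (η 0) (θ 0)
        + ∑ k ∈ Finset.range n,
          (γ * inner ℝ (e k) (θ k - p) + 2 / 3 * γ ^ 2 / μ * ‖e k‖ ^ 2) := by
    intro n
    induction n with
    | zero => simp
    | succ n ih =>
      rw [Finset.sum_range_succ, Finset.sum_range_succ]
      have := dualGap_succ_le hμ hγ hL hLμ hopt (hθ n) (hθ (n + 1)) (hη n)
      linarith
  have := key n
  have := (hθ n).dualGap_nonneg hμ.le (inter_subset_stageDom h g n hp)
  linarith

/-! ### Whitening. -/

open scoped MatrixOrder Matrix.Norms.L2Operator in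
lemma exists_eq_conjTranspose_mul_self {A : Matrix (Fin d) (Fin d) ℝ} (hA : A.PosSemidef) :
    ∃ M : Matrix (Fin d) (Fin d) ℝ, A = Mᴴ * M :=
  CStarAlgebra.nonneg_iff_eq_star_mul_self.1 hA.nonneg

/-- A whitening of a positive definite matrix. -/
theorem exists_whitening {S : Matrix (Fin d) (Fin d) ℝ} (hS : S.PosDef) :
    ∃ (B : Vec d →L[ℝ] Vec d) (b : Fin d → Vec d),
      (∀ u w, inner ℝ (B u) (B (Matrix.toEuclideanLin S w)) = (inner ℝ u w : ℝ)) ∧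
      (∀ i, mahalSq S (b i) = 1) ∧ ∀ u i, B u i = inner ℝ (b i) u := by
  obtain ⟨M, hM⟩ : ∃ M : Matrix (Fin d) (Fin d) ℝ, S⁻¹ = Mᴴ * M :=
    exists_eq_conjTranspose_mul_self hS.inv.posSemidef
  have hdet : IsUnit S.det := (Matrix.isUnit_iff_isUnit_det S).1 hS.isUnit
  have h1 : Mᴴ * (M * S) = 1 := by
    rw [← Matrix.mul_assoc, ← hM, Matrix.nonsing_inv_mul _ hdet]
  -- A one-sided inverse of a square matrix is two-sided. The diagonal of this identity says that
  -- the columns of Mᴴ, which serve as `b`, have unit S-norm.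
  have h2 : M * S * Mᴴ = 1 := mul_eq_one_comm.1 h1
  have hadj : ∀ u v, inner ℝ (Matrix.toEuclideanLin M u) v
      = (inner ℝ u (Matrix.toEuclideanLin Mᴴ v) : ℝ) := by
    intro u v
    rw [Matrix.toEuclideanLin_conjTranspose_eq_adjoint, LinearMap.adjoint_inner_right]
  have hmul : ∀ (P Q : Matrix (Fin d) (Fin d) ℝ) v, Matrix.toEuclideanLin (P * Q) v
      = Matrix.toEuclideanLin P (Matrix.toEuclideanLin Q v) := by
    intro P Q v
    simp [Matrix.toLpLin_apply]
  have hone : ∀ v : Vec d, Matrix.toEuclideanLin (1 : Matrix (Fin d) (Fin d) ℝ) v = v := by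
    intro v
    simp
  refine ⟨LinearMap.toContinuousLinearMap (Matrix.toEuclideanLin M),
    fun i => Matrix.toEuclideanLin Mᴴ (EuclideanSpace.single i 1), ?_, ?_, ?_⟩
  · intro u w
    simp only [LinearMap.coe_toContinuousLinearMap']
    rw [hadj, ← hmul, ← hmul, Matrix.mul_assoc, h1, hone]
  · intro i
    rw [mahalSq, ← hmul, real_inner_comm]
    have : (inner ℝ (Matrix.toEuclideanLin (S * Mᴴ) (EuclideanSpace.single i 1))
        (Matrix.toEuclideanLin Mᴴ (EuclideanSpace.single i 1)) : ℝ)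
        = inner ℝ (Matrix.toEuclideanLin M (Matrix.toEuclideanLin (S * Mᴴ)
          (EuclideanSpace.single i 1))) (EuclideanSpace.single i (1 : ℝ)) := (hadj _ _).symm
    rw [this, ← hmul, ← Matrix.mul_assoc, h2, hone]
    simp
  · intro u i
    simp only [LinearMap.coe_toContinuousLinearMap']
    rw [real_inner_comm, ← hadj]
    simp [EuclideanSpace.inner_single_right]

end DualAveraging

/-! ### Moments of the observations. -/

namespace DualAveraging

variable {d : ℕ} {Ω : Type*} [MeasurableSpace Ω] {P : Measure Ω}

/-- The gradient `(⟨x, θ⟩ - y) x` of the square loss of one observation. -/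
noncomputable def lsGrad (θ : Vec d) (z : Vec d × ℝ) : Vec d :=
  (inner ℝ z.1 θ - z.2) • z.1

lemma integral_add_add {a b c : Ω → ℝ} (ha : Integrable a P) (hb : Integrable b P)
    (hc : Integrable c P) : ∫ ω, (a ω + b ω + c ω) ∂P
      = ∫ ω, a ω ∂P + ∫ ω, b ω ∂P + ∫ ω, c ω ∂P := by
  rw [integral_add (f := fun ω => a ω + b ω) (ha.add hb) hc, integral_add ha hb]

lemma memLp_four_inner {u : Ω → Vec d} (hu : AEStronglyMeasurable u P) {z : Vec d}
    (hz : Integrable (fun ω => (inner ℝ z (u ω)) ^ 4) P) :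
    MemLp (fun ω => (inner ℝ z (u ω) : ℝ)) 4 P := by
  rw [← integrable_norm_rpow_iff (by fun_prop) (by norm_num) (by norm_num)]
  convert hz using 2 with ω
  have : ((4 : ENNReal).toReal) = ((4 : ℕ) : ℝ) := by norm_num
  rw [this, Real.rpow_natCast, Real.norm_eq_abs, Even.pow_abs (by decide)]

/-- In finite dimension the coordinates suffice. Membership in L⁴ is what makes ⟨v, x⟩ x square
integrable. -/
lemma memLp_four_of_inner {u : Ω → Vec d} (hu : AEStronglyMeasurable u P)
    (h : ∀ z : Vec d, Integrable (fun ω => (inner ℝ z (u ω)) ^ 4) P) : MemLp u 4 P := by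
  have e : u = fun ω => ∑ i, (inner ℝ (EuclideanSpace.basisFun (Fin d) ℝ i) (u ω) : ℝ)
      • EuclideanSpace.basisFun (Fin d) ℝ i := by
    funext ω
    exact ((EuclideanSpace.basisFun (Fin d) ℝ).sum_repr' (u ω)).symm
  rw [e]
  refine memLp_finsetSum _ fun i _ => ?_
  refine MemLp.of_le_mul (c := 1) (memLp_four_inner hu (h (EuclideanSpace.basisFun (Fin d) ℝ i)))
    (by fun_prop) (Eventually.of_forall fun ω => ?_)
  rw [norm_smul, (EuclideanSpace.basisFun (Fin d) ℝ).orthonormal.1 i]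
  simp

lemma memLp_two_smul {f : Ω → ℝ} {u : Ω → Vec d} (hf : MemLp f 4 P) (hu : MemLp u 4 P) :
    MemLp (fun ω => f ω • u ω) 2 P := by
  have : ENNReal.HolderTriple 4 4 2 := ⟨by
    have h : (4 : ENNReal) = 2 * 2 := by norm_num
    rw [h, ENNReal.mul_inv (by simp) (by simp), ← mul_add, ENNReal.inv_two_add_inv_two, mul_one]⟩
  exact MemLp.smul (p := 4) (q := 4) (r := 2) hu hf

lemma integrable_inner_mul_inner {u w : Ω → Vec d} (hu : MemLp u 2 P) (hw : MemLp w 2 P)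
    (a b : Vec d) : Integrable (fun ω => (inner ℝ a (u ω) : ℝ) * inner ℝ b (w ω)) P :=
  (hu.const_inner a).integrable_mul (hw.const_inner b)

lemma inner_secondMoment {u : Ω → Vec d} (hu : MemLp u 2 P) (v w : Vec d) :
    (inner ℝ v (Matrix.toEuclideanLin (secondMoment P u) w) : ℝ)
      = ∫ ω, inner ℝ v (u ω) * inner ℝ w (u ω) ∂P := by
  have hint : ∀ i j, Integrable (fun ω => u ω i * u ω j) P := by
    intro i j
    have := integrable_inner_mul_inner hu hu (EuclideanSpace.single i 1)
      (EuclideanSpace.single j 1)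
    simpa [EuclideanSpace.inner_single_left] using this
  have h1 : ∀ ω, (inner ℝ v (u ω) : ℝ) * inner ℝ w (u ω)
      = ∑ i, ∑ j, v i * w j * (u ω i * u ω j) := by
    intro ω
    simp only [PiLp.inner_apply, RCLike.inner_apply, conj_trivial]
    rw [Finset.sum_mul_sum]
    refine Finset.sum_congr rfl fun i _ => Finset.sum_congr rfl fun j _ => by ring
  simp_rw [h1]
  rw [integral_finsetSum _ fun i _ => integrable_finsetSum _ fun j _ => (hint i j).const_mul _]
  simp_rw [integral_finsetSum _ fun j _ => (hint _ j).const_mul _, integral_const_mul]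
  simp only [PiLp.inner_apply, RCLike.inner_apply, conj_trivial, Matrix.toLpLin_apply,
    Matrix.mulVec, dotProduct, secondMoment, Matrix.of_apply, Finset.sum_mul]
  refine Finset.sum_congr rfl fun i _ => Finset.sum_congr rfl fun j _ => by ring

lemma mahalSq_secondMoment {u : Ω → Vec d} (hu : MemLp u 2 P) (v : Vec d) :
    mahalSq (secondMoment P u) v = ∫ ω, (inner ℝ v (u ω)) ^ 2 ∂P := by
  rw [mahalSq, inner_secondMoment hu]
  simp_rw [sq]

lemma mahalSq_nonneg {A : Matrix (Fin d) (Fin d) ℝ} (hA : A.PosSemidef) (v : Vec d) :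
    0 ≤ mahalSq A v := by
  have := hA.dotProduct_mulVec_nonneg v.ofLp
  simpa [mahalSq, PiLp.inner_apply, Matrix.toLpLin_apply, dotProduct, mul_comm] using this

lemma mahalSq_pos {A : Matrix (Fin d) (Fin d) ℝ} (hA : A.PosDef) {v : Vec d} (hv : v ≠ 0) :
    0 < mahalSq A v := by
  have hv' : v.ofLp ≠ 0 := fun h => hv (by ext i; simp [h])
  have := hA.dotProduct_mulVec_pos hv'
  simpa [mahalSq, PiLp.inner_apply, Matrix.toLpLin_apply, dotProduct, mul_comm] using this

lemma mahalSq_smul (A : Matrix (Fin d) (Fin d) ℝ) (t : ℝ) (v : Vec d) :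
    mahalSq A (t • v) = t ^ 2 * mahalSq A v := by
  simp only [mahalSq, map_smul, inner_smul_left, inner_smul_right, conj_trivial]
  ring

lemma mahalSq_le_of_posSemidef {A A' : Matrix (Fin d) (Fin d) ℝ} {c : ℝ}
    (h : (c • A - A').PosSemidef) (v : Vec d) : mahalSq A' v ≤ c * mahalSq A v := by
  have := mahalSq_nonneg h v
  rw [mahalSq, map_sub, map_smul, LinearMap.sub_apply, LinearMap.smul_apply, inner_sub_right,
    inner_smul_right] at this
  rw [mahalSq, mahalSq]
  linarith

lemma integrable_norm_sq {u : Ω → Vec d} (hu : MemLp u 2 P) :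
    Integrable (fun ω => ‖u ω‖ ^ 2) P := hu.integrable_norm_pow (by norm_num)

lemma integral_norm_sq {u : Ω → Vec d} (hu : MemLp u 2 P) :
    ∫ ω, ‖u ω‖ ^ 2 ∂P
      = ∑ i, ∫ ω, (inner ℝ (EuclideanSpace.basisFun (Fin d) ℝ i) (u ω)) ^ 2 ∂P := by
  rw [← integral_finsetSum _ fun i _ => (hu.const_inner _).integrable_sq]
  congr 1
  funext ω
  rw [← (EuclideanSpace.basisFun (Fin d) ℝ).sum_sq_norm_inner_right (u ω)]
  simp

/-- Second moments are at most those of a dominating matrix, summed over an orthonormal basis. -/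
lemma integral_norm_sq_le {u w : Ω → Vec d} (hu : MemLp u 2 P) (hw : MemLp w 2 P) {c : ℝ}
    (h : (c • secondMoment P u - secondMoment P w).PosSemidef) :
    ∫ ω, ‖w ω‖ ^ 2 ∂P ≤ c * ∫ ω, ‖u ω‖ ^ 2 ∂P := by
  rw [integral_norm_sq hu, integral_norm_sq hw, Finset.mul_sum]
  refine Finset.sum_le_sum fun i _ => ?_
  rw [← mahalSq_secondMoment hu, ← mahalSq_secondMoment hw]
  exact mahalSq_le_of_posSemidef h _

/-- The trace of the covariance is bounded by `R ^ 2`. -/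
lemma integral_norm_sq_le_of_fourth [IsProbabilityMeasure P] {u : Ω → Vec d} (hu : MemLp u 4 P)
    {R : ℝ} (h : (R ^ 2 • secondMoment P u
      - secondMoment P (fun ω => ‖u ω‖ • u ω)).PosSemidef) :
    ∫ ω, ‖u ω‖ ^ 2 ∂P ≤ R ^ 2 := by
  have hu2 : MemLp u 2 P := hu.mono_exponent (by norm_num)
  have hw : MemLp (fun ω => ‖u ω‖ • u ω) 2 P := memLp_two_smul hu.norm hu
  have h1 := integral_norm_sq_le hu2 hw h
  have h4 : Integrable (fun ω => (‖u ω‖ ^ 2) ^ 2) P := by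
    have := hu.integrable_norm_pow (p := 4) (by norm_num)
    simpa only [← pow_mul] using this
  -- Jensen's inequality, obtained by integrating (‖u‖² - m)² ≥ 0. Together with `h1` it gives m² ≤
  -- R² m, and m cancels unless it is zero.
  have h2 : (∫ ω, ‖u ω‖ ^ 2 ∂P) ^ 2 ≤ ∫ ω, ‖(‖u ω‖ • u ω)‖ ^ 2 ∂P := by
    set m := ∫ ω, ‖u ω‖ ^ 2 ∂P with hm
    have h5 : ∫ ω, (2 * m * ‖u ω‖ ^ 2 - m ^ 2) ∂P ≤ ∫ ω, (‖u ω‖ ^ 2) ^ 2 ∂P := by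
      refine integral_mono (((integrable_norm_sq hu2).const_mul _).sub (integrable_const _)) h4
        fun ω => ?_
      have : 0 ≤ (‖u ω‖ ^ 2 - m) ^ 2 := sq_nonneg _
      simp only
      linarith
    rw [integral_sub ((integrable_norm_sq hu2).const_mul _) (integrable_const _),
      integral_const_mul, integral_const, ← hm] at h5
    simp only [probReal_univ, smul_eq_mul, one_mul] at h5
    have e : ∀ ω, ‖(‖u ω‖ • u ω)‖ ^ 2 = (‖u ω‖ ^ 2) ^ 2 := by
      intro ω
      rw [norm_smul, norm_norm]
      ring
    simp_rw [e]
    linarith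
  have h0 : 0 ≤ ∫ ω, ‖u ω‖ ^ 2 ∂P := integral_nonneg fun ω => by positivity
  rcases h0.eq_or_lt with h3 | h3
  · rw [← h3]; positivity
  · have := h2.trans h1
    rw [sq] at this
    exact le_of_mul_le_mul_right this h3

lemma mahalSq_secondMoment_le {u : Ω → Vec d} (hu : MemLp u 2 P) (v : Vec d) :
    mahalSq (secondMoment P u) v ≤ (∫ ω, ‖u ω‖ ^ 2 ∂P) * ‖v‖ ^ 2 := by
  rw [mahalSq_secondMoment hu, ← integral_mul_const]
  refine integral_mono (hu.const_inner v).integrable_sq ((integrable_norm_sq hu).mul_const _)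
    fun ω => ?_
  have := abs_real_inner_le_norm v (u ω)
  calc (inner ℝ v (u ω)) ^ 2 = |inner ℝ v (u ω)| ^ 2 := (sq_abs _).symm
    _ ≤ (‖v‖ * ‖u ω‖) ^ 2 := by gcongr
    _ = ‖u ω‖ ^ 2 * ‖v‖ ^ 2 := by ring

lemma integrable_inner_sq_mul_inner_sq {u : Ω → Vec d} (hu : MemLp u 4 P) (v b : Vec d) :
    Integrable (fun ω => (inner ℝ v (u ω)) ^ 2 * (inner ℝ b (u ω)) ^ 2 : Ω → ℝ) P := by
  have h1 := memLp_two_smul (hu.const_inner v) hu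
  have := (h1.const_inner b).integrable_sq
  refine this.congr (Eventually.of_forall fun ω => ?_)
  simp only [inner_smul_right]
  ring

/-- Cauchy–Schwarz for the two fourth moments, in the form of a weighted arithmetic-geometric
inequality. The weight t = ‖v‖_S² balances the two terms, since b has unit S-norm. -/
lemma integral_inner_sq_mul_inner_sq_le {u : Ω → Vec d} (hu : MemLp u 4 P)
    (hS : (secondMoment P u).PosDef) {κ : ℝ}
    (hkurt_int : ∀ z : Vec d, Integrable (fun ω => (inner ℝ z (u ω)) ^ 4) P)
    (hkurt : ∀ z : Vec d, ∫ ω, (inner ℝ z (u ω)) ^ 4 ∂P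
      ≤ κ * mahalSq (secondMoment P u) z ^ 2) (v b : Vec d)
    (hb : mahalSq (secondMoment P u) b = 1) :
    ∫ ω, ((inner ℝ v (u ω)) ^ 2 * (inner ℝ b (u ω)) ^ 2 : ℝ) ∂P
      ≤ κ * mahalSq (secondMoment P u) v := by
  by_cases hv : v = 0
  · simp [hv, mahalSq]
  set t := mahalSq (secondMoment P u) v with ht
  have htpos : 0 < t := mahalSq_pos hS hv
  have h1 : ∫ ω, ((inner ℝ v (u ω)) ^ 2 * (inner ℝ b (u ω)) ^ 2 : ℝ) ∂P
      ≤ ∫ ω, ((2 * t)⁻¹ * (inner ℝ v (u ω)) ^ 4 + t / 2 * (inner ℝ b (u ω)) ^ 4 : ℝ) ∂P := by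
    refine integral_mono (integrable_inner_sq_mul_inner_sq hu v b)
      (((hkurt_int v).const_mul _).add ((hkurt_int b).const_mul _)) fun ω => ?_
    set a := (inner ℝ v (u ω) : ℝ)
    set c := (inner ℝ b (u ω) : ℝ)
    have e : (2 * t)⁻¹ * a ^ 4 + t / 2 * c ^ 4 - a ^ 2 * c ^ 2
        = (2 * t)⁻¹ * (a ^ 2 - t * c ^ 2) ^ 2 := by
      field_simp
      ring
    have : 0 ≤ (2 * t)⁻¹ * (a ^ 2 - t * c ^ 2) ^ 2 := by positivity
    simp only
    linarith
  rw [integral_add ((hkurt_int v).const_mul _) ((hkurt_int b).const_mul _), integral_const_mul,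
    integral_const_mul] at h1
  have h2 := hkurt v
  have h3 := hkurt b
  rw [hb, one_pow, mul_one] at h3
  have h4 : (2 * t)⁻¹ * ∫ ω, (inner ℝ v (u ω)) ^ 4 ∂P ≤ (2 * t)⁻¹ * (κ * t ^ 2) := by gcongr
  have h5 : t / 2 * ∫ ω, (inner ℝ b (u ω)) ^ 4 ∂P ≤ t / 2 * κ := by gcongr
  have h6 : (2 * t)⁻¹ * (κ * t ^ 2) + t / 2 * κ = κ * t := by field_simp; ring
  linarith

/-- Jensen: ⟨b, x⟩² has mean 1, so its second moment is at least 1. -/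
lemma one_le_kurtosis [IsProbabilityMeasure P] {u : Ω → Vec d} (hu : MemLp u 4 P) {κ : ℝ}
    (hkurt_int : ∀ z : Vec d, Integrable (fun ω => (inner ℝ z (u ω)) ^ 4) P)
    (hkurt : ∀ z : Vec d, ∫ ω, (inner ℝ z (u ω)) ^ 4 ∂P
      ≤ κ * mahalSq (secondMoment P u) z ^ 2) {b : Vec d}
    (hb : mahalSq (secondMoment P u) b = 1) : 1 ≤ κ := by
  have hu2 : MemLp u 2 P := hu.mono_exponent (by norm_num)
  have h3 := hkurt b
  have h2 := mahalSq_secondMoment hu2 b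
  rw [hb] at h2
  rw [hb, one_pow, mul_one] at h3
  have hi := (hu2.const_inner b).integrable_sq
  have h5 : ∫ ω, (2 * (inner ℝ b (u ω)) ^ 2 - 1 : ℝ) ∂P ≤ ∫ ω, (inner ℝ b (u ω)) ^ 4 ∂P := by
    refine integral_mono ((hi.const_mul _).sub (integrable_const _)) (hkurt_int b) fun ω => ?_
    have : 0 ≤ ((inner ℝ b (u ω) : ℝ) ^ 2 - 1) ^ 2 := sq_nonneg _
    simp only
    nlinarith
  rw [integral_sub (hi.const_mul _) (integrable_const _), integral_const_mul, ← h2,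
    integral_const] at h5
  simp only [probReal_univ, smul_eq_mul, one_mul] at h5
  linarith

/-! ### The least-squares gradient and its noise. -/

lemma lsGrad_eq {α : Type*} (c θ : Vec d) (x : α → Vec d) (y : α → ℝ) (ω : α) :
    lsGrad θ (x ω, y ω) = (inner ℝ (θ - c) (x ω) : ℝ) • x ω - lsResidual x y c ω := by
  rw [lsGrad, lsResidual, inner_sub_left, ← sub_smul, real_inner_comm]
  congr 1
  ring

lemma memLp_lsGrad {x : Ω → Vec d} {y : Ω → ℝ} (hx : MemLp x 4 P) {c : Vec d}
    (hξ : MemLp (lsResidual x y c) 2 P) (θ : Vec d) :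
    MemLp (fun ω => lsGrad θ (x ω, y ω)) 2 P := by
  simp_rw [lsGrad_eq c]
  exact (memLp_two_smul (hx.const_inner (θ - c)) hx).sub hξ

/-- Second order expansion of the least-squares risk. -/
lemma lsRisk_expansion [IsProbabilityMeasure P] {x : Ω → Vec d} {y : Ω → ℝ} (hx : MemLp x 4 P)
    (hy : MemLp y 2 P) {c : Vec d} (hξ : MemLp (lsResidual x y c) 2 P) (p z : Vec d) :
    lsRisk P x y z = lsRisk P x y p + inner ℝ (∫ ω, lsGrad p (x ω, y ω) ∂P) (z - p)
      + 1 / 2 * mahalSq (secondMoment P x) (z - p) := by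
  have hx2 : MemLp x 2 P := hx.mono_exponent (by norm_num)
  have hr : MemLp (fun ω => (inner ℝ (x ω) p : ℝ) - y ω) 2 P := (hx2.inner_const p).sub hy
  have hg := memLp_lsGrad hx hξ p
  have h1 : (inner ℝ (∫ ω, lsGrad p (x ω, y ω) ∂P) (z - p) : ℝ)
      = ∫ ω, inner ℝ (z - p) (lsGrad p (x ω, y ω)) ∂P := by
    rw [real_inner_comm, ← integral_inner (hg.integrable (by norm_num))]
  have e : ∀ ω, ((inner ℝ (x ω) z : ℝ) - y ω) ^ 2 = ((inner ℝ (x ω) p : ℝ) - y ω) ^ 2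
      + 2 * inner ℝ (z - p) (lsGrad p (x ω, y ω)) + (inner ℝ (z - p) (x ω)) ^ 2 := by
    intro ω
    have : (inner ℝ (x ω) z : ℝ) = inner ℝ (x ω) p + inner ℝ (z - p) (x ω) := by
      rw [inner_sub_left, real_inner_comm z, real_inner_comm p]; ring
    rw [lsGrad, inner_smul_right, this]
    ring
  have hi2 : Integrable (fun ω => (inner ℝ (z - p) (lsGrad p (x ω, y ω)) : ℝ)) P :=
    (hg.const_inner _).integrable (by norm_num)
  rw [lsRisk, lsRisk, h1, mahalSq_secondMoment hx2]
  simp_rw [e]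
  rw [integral_add_add hr.integrable_sq (hi2.const_mul 2) (hx2.const_inner (z - p)).integrable_sq,
    integral_const_mul]
  ring

/-- The mean of the stochastic gradient, in terms of a minimizer `c` of the risk. -/
lemma integral_lsGrad [IsProbabilityMeasure P] {x : Ω → Vec d} {y : Ω → ℝ} (hx : MemLp x 4 P)
    (hy : MemLp y 2 P) {c : Vec d} (hξ : MemLp (lsResidual x y c) 2 P)
    (hc : ∀ θ, lsRisk P x y c ≤ lsRisk P x y θ) (θ : Vec d) :
    ∫ ω, lsGrad θ (x ω, y ω) ∂P = Matrix.toEuclideanLin (secondMoment P x) (θ - c) := by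
  have hx2 : MemLp x 2 P := hx.mono_exponent (by norm_num)
  have h0 : ∫ ω, lsGrad c (x ω, y ω) ∂P = 0 := by
    set w := ∫ ω, lsGrad c (x ω, y ω) ∂P with hw
    -- A step of length t along -w lowers the risk to first order by t‖w‖², so minimality of c
    -- leaves only the second-order term to bound it.
    have key : ∀ t ∈ Set.Ioo (0 : ℝ) 1,
        ‖w‖ ^ 2 ≤ t * (1 / 2 * mahalSq (secondMoment P x) w) := by
      intro t ht
      have h1 := hc (c + (-t) • w)
      rw [lsRisk_expansion hx hy hξ c (c + (-t) • w), add_sub_cancel_left, mahalSq_smul,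
        inner_smul_right, ← hw, real_inner_self_eq_norm_sq] at h1
      have : t * ‖w‖ ^ 2 ≤ t * (t * (1 / 2 * mahalSq (secondMoment P x) w)) := by linarith
      exact le_of_mul_le_mul_left this ht.1
    have hlim : Tendsto (fun t : ℝ => t * (1 / 2 * mahalSq (secondMoment P x) w)) (𝓝[>] 0)
        (𝓝 (0 * (1 / 2 * mahalSq (secondMoment P x) w))) :=
      Tendsto.mono_left (Continuous.tendsto (by fun_prop) 0) nhdsWithin_le_nhds
    have := ge_of_tendsto hlim
      (by filter_upwards [Ioo_mem_nhdsGT (zero_lt_one' ℝ)] with t ht using key t ht)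
    rw [zero_mul] at this
    have h2 : ‖w‖ = 0 := by nlinarith [norm_nonneg w]
    exact norm_eq_zero.1 h2
  refine ext_inner_left ℝ fun v => ?_
  rw [inner_secondMoment hx2, ← integral_inner ((memLp_lsGrad hx hξ θ).integrable (by norm_num))]
  have h1 : ∫ ω, (inner ℝ v (lsGrad c (x ω, y ω)) : ℝ) ∂P = 0 := by
    rw [integral_inner ((memLp_lsGrad hx hξ c).integrable (by norm_num)), h0, inner_zero_right]
  have e : ∀ ω, (inner ℝ v (lsGrad θ (x ω, y ω)) : ℝ)
      = inner ℝ v (x ω) * inner ℝ (θ - c) (x ω) + inner ℝ v (lsGrad c (x ω, y ω)) := by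
    intro ω
    have : (inner ℝ (x ω) θ : ℝ) = inner ℝ (x ω) c + inner ℝ (θ - c) (x ω) := by
      rw [inner_sub_left, real_inner_comm θ, real_inner_comm c]; ring
    rw [lsGrad, lsGrad, inner_smul_right, inner_smul_right, this]
    ring
  simp_rw [e]
  rw [integral_add (integrable_inner_mul_inner hx2 hx2 _ _)
    (((memLp_lsGrad hx hξ c).const_inner v).integrable (by norm_num)), h1, add_zero]

/-- The variance is at most the second moment, after a linear map. -/
lemma integral_norm_sq_map_sub_le [IsProbabilityMeasure P] {u : Ω → Vec d} (hu : MemLp u 2 P)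
    (T : Vec d →L[ℝ] Vec d) :
    ∫ ω, ‖T ((∫ ω', u ω' ∂P) - u ω)‖ ^ 2 ∂P ≤ ∫ ω, ‖T (u ω)‖ ^ 2 ∂P := by
  set m := ∫ ω', u ω' ∂P with hm
  have hTu : MemLp (fun ω => T (u ω)) 2 P := T.comp_memLp' hu
  have hi : Integrable (fun ω => (inner ℝ (T m) (T (u ω)) : ℝ)) P :=
    (hTu.const_inner _).integrable (by norm_num)
  have e : ∀ ω, ‖T (m - u ω)‖ ^ 2
      = ‖T (u ω)‖ ^ 2 + ‖T m‖ ^ 2 + (-2) * inner ℝ (T m) (T (u ω)) := by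
    intro ω
    rw [map_sub, norm_sub_sq_real]
    ring
  have h1 : ∫ ω, (inner ℝ (T m) (T (u ω)) : ℝ) ∂P = ‖T m‖ ^ 2 := by
    rw [integral_inner (hTu.integrable (by norm_num)),
      T.integral_comp_comm (hu.integrable (by norm_num)), ← hm, real_inner_self_eq_norm_sq]
  simp_rw [e]
  rw [integral_add_add (integrable_norm_sq hTu) (integrable_const (‖T m‖ ^ 2)) (hi.const_mul (-2)),
    integral_const_mul, h1, integral_const]
  simp only [probReal_univ, smul_eq_mul, one_mul]
  have : 0 ≤ ‖T m‖ ^ 2 := by positivity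
  linarith

/-- Bound on the gradient noise after a linear map. -/
lemma integral_noise_le [IsProbabilityMeasure P] {x : Ω → Vec d} {y : Ω → ℝ} (hx : MemLp x 4 P)
    (hy : MemLp y 2 P) {c : Vec d} (hξ : MemLp (lsResidual x y c) 2 P)
    (hc : ∀ θ, lsRisk P x y c ≤ lsRisk P x y θ) (T : Vec d →L[ℝ] Vec d) {a b : ℝ}
    (ha : ∫ ω, ‖T (lsResidual x y c ω)‖ ^ 2 ∂P ≤ a)
    (hb : ∀ v : Vec d, ∫ ω, ‖T ((inner ℝ v (x ω) : ℝ) • x ω)‖ ^ 2 ∂P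
      ≤ b * mahalSq (secondMoment P x) v) (p θ : Vec d) :
    ∫ ω, ‖T (Matrix.toEuclideanLin (secondMoment P x) (θ - c) - lsGrad θ (x ω, y ω))‖ ^ 2 ∂P
      ≤ 3 * (a + b * mahalSq (secondMoment P x) (p - c)
        + b * mahalSq (secondMoment P x) (θ - p)) := by
  rw [← integral_lsGrad hx hy hξ hc θ]
  refine (integral_norm_sq_map_sub_le (memLp_lsGrad hx hξ θ) T).trans ?_
  have hi : ∀ v : Vec d, Integrable (fun ω => ‖T ((inner ℝ v (x ω) : ℝ) • x ω)‖ ^ 2) P :=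
    fun v => integrable_norm_sq (T.comp_memLp' (memLp_two_smul (hx.const_inner v) hx))
  have hi3 : Integrable (fun ω => ‖T (lsResidual x y c ω)‖ ^ 2) P :=
    integrable_norm_sq (T.comp_memLp' hξ)
  have h1 : ∫ ω, ‖T (lsGrad θ (x ω, y ω))‖ ^ 2 ∂P
      ≤ ∫ ω, 3 * (‖T (lsResidual x y c ω)‖ ^ 2 + ‖T ((inner ℝ (p - c) (x ω) : ℝ) • x ω)‖ ^ 2
        + ‖T ((inner ℝ (θ - p) (x ω) : ℝ) • x ω)‖ ^ 2) ∂P := by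
    refine integral_mono (integrable_norm_sq (T.comp_memLp' (memLp_lsGrad hx hξ θ)))
      (((hi3.add (hi _)).add (hi _)).const_mul 3) fun ω => ?_
    set A := T (lsResidual x y c ω)
    set D := T ((inner ℝ (p - c) (x ω) : ℝ) • x ω) with hD
    set E := T ((inner ℝ (θ - p) (x ω) : ℝ) • x ω) with hE
    -- Passing from c to θ through p separates the residual at c, the bias p - c and the error θ -
    -- p; the factor 3 comes from squaring a sum of three terms.
    have e : T (lsGrad θ (x ω, y ω)) = E + D - A := by
      rw [lsGrad_eq c, map_sub, hE, hD, ← map_add, ← add_smul, ← inner_add_left,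
        sub_add_sub_cancel]
    have n1 : ‖E + D - A‖ ≤ ‖E‖ + ‖D‖ + ‖A‖ :=
      (norm_sub_le _ _).trans (by gcongr; exact norm_add_le _ _)
    have n2 : ‖E + D - A‖ ^ 2 ≤ (‖E‖ + ‖D‖ + ‖A‖) ^ 2 := by gcongr
    simp only
    rw [e]
    nlinarith [sq_nonneg (‖E‖ - ‖D‖), sq_nonneg (‖E‖ - ‖A‖), sq_nonneg (‖D‖ - ‖A‖)]
  refine h1.trans ?_
  rw [integral_const_mul, integral_add_add hi3 (hi (p - c)) (hi (θ - p))]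
  have := hb (p - c)
  have := hb (θ - p)
  linarith

end DualAveraging

namespace DualAveraging

/-! ### Freezing the past under independence. -/

section Independence

variable {Ω α β : Type*} {m mΩ : MeasurableSpace Ω} [MeasurableSpace α] [MeasurableSpace β]
  {P : Measure Ω}

lemma indepFun_of_indep_comap {X : Ω → α} {Z : Ω → β} (hX : Measurable[m] X)
    (h : Indep m (MeasurableSpace.comap Z inferInstance) P) : IndepFun X Z P := by
  rw [IndepFun_iff_Indep]
  exact indep_of_indep_of_le_left h hX.comap_le

variable [IsProbabilityMeasure P]

lemma map_prodMk_eq {X : Ω → α} {Z Z₀ : Ω → β} (hX : Measurable X) (hZ : Measurable Z)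
    (hXZ : IndepFun X Z P) (hid : IdentDistrib Z Z₀ P P) :
    P.map (fun ω => (X ω, Z ω)) = (P.map X).prod (P.map Z₀) := by
  rw [(indepFun_iff_map_prod_eq_prod_map_map hX.aemeasurable hZ.aemeasurable).1 hXZ, hid.map_eq]

/-- This plays the role of conditional expectation. The joint law is a product, so Fubini allows X
to be frozen at s; the integrable majorant ψ also yields integrability, which is not known
beforehand. -/
lemma integrable_and_integral_le_of_indepFun {X : Ω → α} {Z Z₀ : Ω → β} (hX : Measurable X)
    (hZ : Measurable Z) (hZ₀ : Measurable Z₀) (hXZ : IndepFun X Z P)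
    (hid : IdentDistrib Z Z₀ P P) {Φ : α × β → ℝ}
    (hΦ : Measurable Φ) (hΦ0 : ∀ p, 0 ≤ Φ p) {ψ : α → ℝ} (hψ : Measurable ψ)
    (hi : ∀ s, Integrable (fun ω => Φ (s, Z₀ ω)) P) (hle : ∀ s, ∫ ω, Φ (s, Z₀ ω) ∂P ≤ ψ s)
    (hψi : Integrable (fun ω => ψ (X ω)) P) :
    Integrable (fun ω => Φ (X ω, Z ω)) P ∧ ∫ ω, Φ (X ω, Z ω) ∂P ≤ ∫ ω, ψ (X ω) ∂P := by
  have hmap := map_prodMk_eq hX hZ hXZ hid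
  have : IsProbabilityMeasure (P.map X) := Measure.isProbabilityMeasure_map hX.aemeasurable
  have : IsProbabilityMeasure (P.map Z₀) := Measure.isProbabilityMeasure_map hZ₀.aemeasurable
  have hs : ∀ s, Measurable fun z => Φ (s, z) := fun s => hΦ.comp measurable_prodMk_left
  have hmi : ∀ s, ∫ z, Φ (s, z) ∂(P.map Z₀) = ∫ ω, Φ (s, Z₀ ω) ∂P := fun s =>
    integral_map hZ₀.aemeasurable (hs s).aestronglyMeasurable
  have hψm : Integrable ψ (P.map X) :=
    (integrable_map_measure hψ.aestronglyMeasurable hX.aemeasurable).2 hψi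
  have hF : Integrable Φ ((P.map X).prod (P.map Z₀)) := by
    rw [integrable_prod_iff hΦ.aestronglyMeasurable]
    refine ⟨Eventually.of_forall fun s => ?_, ?_⟩
    · exact (integrable_map_measure (hs s).aestronglyMeasurable hZ₀.aemeasurable).2 (hi s)
    · refine hψm.mono' ?_ (Eventually.of_forall fun s => ?_)
      · exact (hΦ.norm.stronglyMeasurable.integral_prod_right).aestronglyMeasurable
      · simp only [Real.norm_eq_abs, abs_of_nonneg (hΦ0 _)]
        rw [hmi, abs_of_nonneg (integral_nonneg fun ω => hΦ0 _)]
        exact hle s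
  have hpair : Measurable fun ω => (X ω, Z ω) := hX.prodMk hZ
  refine ⟨?_, ?_⟩
  · rw [← hmap] at hF
    exact (integrable_map_measure hΦ.aestronglyMeasurable hpair.aemeasurable).1 hF
  · have e : ∫ ω, Φ (X ω, Z ω) ∂P = ∫ p, Φ p ∂(P.map fun ω => (X ω, Z ω)) :=
      (integral_map hpair.aemeasurable hΦ.aestronglyMeasurable).symm
    have e2 : ∫ ω, ψ (X ω) ∂P = ∫ s, ψ s ∂(P.map X) :=
      (integral_map hX.aemeasurable hψ.aestronglyMeasurable).symm
    rw [e, e2, hmap, integral_prod _ hF]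
    refine integral_mono hF.integral_prod_left hψm fun s => ?_
    simp only
    rw [hmi]
    exact hle s

/-- The same freezing argument; Φ has no sign here, so integrability has to be supplied. -/
lemma integral_eq_zero_of_indepFun {X : Ω → α} {Z Z₀ : Ω → β} (hX : Measurable X)
    (hZ : Measurable Z) (hZ₀ : Measurable Z₀) (hXZ : IndepFun X Z P)
    (hid : IdentDistrib Z Z₀ P P) {Φ : α × β → ℝ}
    (hΦ : Measurable Φ) (hz : ∀ s, ∫ ω, Φ (s, Z₀ ω) ∂P = 0)
    (hi : Integrable (fun ω => Φ (X ω, Z ω)) P) :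
    ∫ ω, Φ (X ω, Z ω) ∂P = 0 := by
  have hmap := map_prodMk_eq hX hZ hXZ hid
  have : IsProbabilityMeasure (P.map X) := Measure.isProbabilityMeasure_map hX.aemeasurable
  have : IsProbabilityMeasure (P.map Z₀) := Measure.isProbabilityMeasure_map hZ₀.aemeasurable
  have hpair : Measurable fun ω => (X ω, Z ω) := hX.prodMk hZ
  have hF := (integrable_map_measure hΦ.aestronglyMeasurable hpair.aemeasurable).2 hi
  have e : ∫ ω, Φ (X ω, Z ω) ∂P = ∫ p, Φ p ∂(P.map fun ω => (X ω, Z ω)) :=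
    (integral_map hpair.aemeasurable hΦ.aestronglyMeasurable).symm
  rw [hmap] at hF
  rw [e, hmap, integral_prod _ hF]
  have hmi : ∀ s, ∫ z, Φ (s, z) ∂(P.map Z₀) = 0 := fun s => by
    have hs : Measurable fun z => Φ (s, z) := hΦ.comp measurable_prodMk_left
    rw [integral_map hZ₀.aemeasurable hs.aestronglyMeasurable, hz s]
  simp_rw [hmi]
  simp

end Independence

/-! ### The filtration of the observations. -/

section Past

variable {Ω β : Type*} [MeasurableSpace β]

/-- The `σ`-algebra generated by the first `k` observations. -/
abbrev past (Z : ℕ → Ω → β) (k : ℕ) : MeasurableSpace Ω :=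
  ⨆ i ∈ Set.Iio k, MeasurableSpace.comap (Z i) inferInstance

lemma past_mono (Z : ℕ → Ω → β) (k : ℕ) : past Z k ≤ past Z (k + 1) :=
  biSup_mono fun _ hi => lt_trans hi (Nat.lt_succ_self k)

lemma past_le {mΩ : MeasurableSpace Ω} {Z : ℕ → Ω → β} (hZ : ∀ k, Measurable (Z k)) (k : ℕ) : past Z k ≤ mΩ :=
  iSup₂_le fun i _ => (hZ i).comap_le

lemma measurable_past_succ (Z : ℕ → Ω → β) (k : ℕ) : Measurable[past Z (k + 1)] (Z k) := by
  rw [measurable_iff_comap_le]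
  exact le_biSup (fun i => MeasurableSpace.comap (Z i) inferInstance)
    (show k ∈ Set.Iio (k + 1) from Nat.lt_succ_self k)

lemma indep_past {mΩ : MeasurableSpace Ω} {P : Measure Ω} {Z : ℕ → Ω → β} (hZ : ∀ k, Measurable (Z k)) (h : iIndepFun Z P) (k : ℕ) :
    Indep (past Z k) (MeasurableSpace.comap (Z k) inferInstance) P := by
  have := indep_iSup_of_disjoint (fun i => (hZ i).comap_le) h.iIndep
    (S := Set.Iio k) (T := {k}) (by simp)
  simpa [past] using this

end Past

/-! ### Gradient noise at a random, past-dependent point. -/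

section Noise

variable {d : ℕ} {Ω : Type*} {m mΩ : MeasurableSpace Ω} {P : Measure Ω}

/-- The centred gradient noise at `θ`, for the mean gradient `θ ↦ S (θ - c)`. -/
noncomputable def gradNoise (S : Matrix (Fin d) (Fin d) ℝ) (c θ : Vec d) (z : Vec d × ℝ) : Vec d :=
  Matrix.toEuclideanLin S (θ - c) - lsGrad θ z

lemma continuous_toEuclideanLin (S : Matrix (Fin d) (Fin d) ℝ) :
    Continuous (Matrix.toEuclideanLin S) := LinearMap.continuous_of_finiteDimensional _

lemma continuous_mahalSq (S : Matrix (Fin d) (Fin d) ℝ) : Continuous (mahalSq S) := by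
  unfold mahalSq
  exact continuous_id.inner (continuous_toEuclideanLin S)

lemma continuous_lsGrad : Continuous (fun p : Vec d × (Vec d × ℝ) => lsGrad p.1 p.2) := by
  unfold lsGrad
  fun_prop

lemma continuous_gradNoise (S : Matrix (Fin d) (Fin d) ℝ) (c : Vec d) :
    Continuous (fun p : Vec d × (Vec d × ℝ) => gradNoise S c p.1 p.2) := by
  unfold gradNoise
  exact ((continuous_toEuclideanLin S).comp (by fun_prop)).sub continuous_lsGrad

lemma measurable_gradNoise_comp (S : Matrix (Fin d) (Fin d) ℝ) (c : Vec d) {θ : Ω → Vec d}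
    {Z : Ω → Vec d × ℝ} (hθ : Measurable[m] θ) (hZ : Measurable[m] Z) :
    Measurable[m] (fun ω => gradNoise S c (θ ω) (Z ω)) := by
  have h : Measurable[m] (fun ω => (θ ω, Z ω)) := hθ.prodMk hZ
  have h' := (continuous_gradNoise S c).measurable.comp h
  simp only [Function.comp_def] at h'
  exact h'

lemma memLp_toEuclideanLin (S : Matrix (Fin d) (Fin d) ℝ) {v : Ω → Vec d} (hv : MemLp v 2 P) :
    MemLp (fun ω => Matrix.toEuclideanLin S (v ω)) 2 P :=
  (LinearMap.toContinuousLinearMap (Matrix.toEuclideanLin S)).comp_memLp' hv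

lemma integrable_inner_of_memLp {u v : Ω → Vec d} (hu : MemLp u 2 P) (hv : MemLp v 2 P) :
    Integrable (fun ω => (inner ℝ (u ω) (v ω) : ℝ)) P := by
  refine Integrable.mono' (hu.norm.integrable_mul hv.norm)
    (hu.aestronglyMeasurable.inner hv.aestronglyMeasurable)
    (Eventually.of_forall fun ω => ?_)
  exact abs_real_inner_le_norm _ _

lemma integrable_mahalSq (S : Matrix (Fin d) (Fin d) ℝ) {v : Ω → Vec d} (hv : MemLp v 2 P) :
    Integrable (fun ω => mahalSq S (v ω)) P :=
  integrable_inner_of_memLp hv (memLp_toEuclideanLin S hv)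

variable [IsProbabilityMeasure P]

/-- The expected squared gradient noise at a point that depends on the past. -/
lemma integral_gradNoise_le {S : Matrix (Fin d) (Fin d) ℝ} {c p : Vec d} {θ : Ω → Vec d}
    {Z Z₀ : Ω → Vec d × ℝ} (hm : m ≤ mΩ) (hθm : Measurable[m] θ) (hθ : MemLp θ 2 P)
    (hZ : Measurable Z) (hZ₀ : Measurable Z₀)
    (hind : Indep m (MeasurableSpace.comap Z inferInstance) P) (hid : IdentDistrib Z Z₀ P P)
    (hL2 : ∀ s, MemLp (fun ω => gradNoise S c s (Z₀ ω)) 2 P) (T : Vec d →L[ℝ] Vec d) {a b : ℝ}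
    (hab : ∀ s, ∫ ω, ‖T (gradNoise S c s (Z₀ ω))‖ ^ 2 ∂P ≤ a + b * mahalSq S (s - p)) :
    Integrable (fun ω => ‖T (gradNoise S c (θ ω) (Z ω))‖ ^ 2) P ∧
    ∫ ω, ‖T (gradNoise S c (θ ω) (Z ω))‖ ^ 2 ∂P ≤ a + b * ∫ ω, mahalSq S (θ ω - p) ∂P := by
  have hq : Integrable (fun ω => mahalSq S (θ ω - p)) P :=
    integrable_mahalSq S (hθ.sub (memLp_const p))
  have h1 := integrable_and_integral_le_of_indepFun (X := θ) (Z := Z) (Z₀ := Z₀) (P := P)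
    (Φ := fun q => ‖T (gradNoise S c q.1 q.2)‖ ^ 2) (ψ := fun s => a + b * mahalSq S (s - p))
    (hθm.mono hm le_rfl) hZ hZ₀ (indepFun_of_indep_comap hθm hind) hid
    (((T.continuous.comp (continuous_gradNoise S c)).norm.pow 2).measurable)
    (fun q => by positivity)
    (Continuous.measurable (continuous_const.add (continuous_const.mul
      ((continuous_mahalSq S).comp (by fun_prop)))))
    (fun s => integrable_norm_sq (T.comp_memLp' (hL2 s))) hab
    ((integrable_const _).add (hq.const_mul b))
  refine ⟨h1.1, h1.2.trans (le_of_eq ?_)⟩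
  rw [integral_add (integrable_const _) (hq.const_mul b), integral_const_mul, integral_const]
  simp

/-- The noise contains ⟨x, θ⟩ x with θ only in L², so its square integrability relies on
independence and on the affine second-moment bound. -/
lemma memLp_gradNoise {S : Matrix (Fin d) (Fin d) ℝ} {c p : Vec d} {θ : Ω → Vec d}
    {Z Z₀ : Ω → Vec d × ℝ} (hm : m ≤ mΩ) (hθm : Measurable[m] θ) (hθ : MemLp θ 2 P)
    (hZ : Measurable Z) (hZ₀ : Measurable Z₀)
    (hind : Indep m (MeasurableSpace.comap Z inferInstance) P) (hid : IdentDistrib Z Z₀ P P)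
    (hL2 : ∀ s, MemLp (fun ω => gradNoise S c s (Z₀ ω)) 2 P) {a b : ℝ}
    (hab : ∀ s, ∫ ω, ‖gradNoise S c s (Z₀ ω)‖ ^ 2 ∂P ≤ a + b * mahalSq S (s - p)) :
    MemLp (fun ω => gradNoise S c (θ ω) (Z ω)) 2 P := by
  have h1 := (integral_gradNoise_le hm hθm hθ hZ hZ₀ hind hid hL2
    (ContinuousLinearMap.id ℝ (Vec d)) hab).1
  refine (memLp_two_iff_integrable_sq_norm ?_).2 h1
  exact ((continuous_gradNoise S c).measurable.comp
    ((hθm.mono hm le_rfl).prodMk hZ)).aestronglyMeasurable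

/-- The gradient noise is orthogonal to the past. -/
lemma integral_inner_gradNoise {S : Matrix (Fin d) (Fin d) ℝ} {c : Vec d} {θ W : Ω → Vec d}
    {Z Z₀ : Ω → Vec d × ℝ} (hm : m ≤ mΩ) (hθm : Measurable[m] θ)
    (hWm : Measurable[m] W) (hW : MemLp W 2 P) (hZ : Measurable Z) (hZ₀ : Measurable Z₀)
    (hind : Indep m (MeasurableSpace.comap Z inferInstance) P) (hid : IdentDistrib Z Z₀ P P)
    (hL2 : ∀ s, MemLp (fun ω => gradNoise S c s (Z₀ ω)) 2 P)
    (hmean : ∀ s, ∫ ω, gradNoise S c s (Z₀ ω) ∂P = 0)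
    (he : MemLp (fun ω => gradNoise S c (θ ω) (Z ω)) 2 P) (T : Vec d →L[ℝ] Vec d) :
    ∫ ω, (inner ℝ (T (W ω)) (T (gradNoise S c (θ ω) (Z ω))) : ℝ) ∂P = 0 := by
  have hXm : Measurable[m] (fun ω => (W ω, θ ω)) := hWm.prodMk hθm
  refine integral_eq_zero_of_indepFun (X := fun ω => (W ω, θ ω)) (Z := Z) (Z₀ := Z₀) (P := P)
    (Φ := fun q => (inner ℝ (T q.1.1) (T (gradNoise S c q.1.2 q.2)) : ℝ))
    (hXm.mono hm le_rfl) hZ hZ₀ (indepFun_of_indep_comap hXm hind) hid ?_ ?_ ?_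
  · refine Continuous.measurable (Continuous.inner (by fun_prop) (T.continuous.comp ?_))
    exact (continuous_gradNoise S c).comp (g := fun p : Vec d × (Vec d × ℝ) => gradNoise S c p.1 p.2)
      (f := fun q : (Vec d × Vec d) × (Vec d × ℝ) => (q.1.2, q.2)) (by fun_prop)
  · intro s
    have hi := (hL2 s.2).integrable (by norm_num)
    simp only
    rw [integral_inner (T.integrable_comp hi), T.integral_comp_comm hi, hmean, map_zero,
      inner_zero_right]
  · exact integrable_inner_of_memLp (T.comp_memLp' hW) (T.comp_memLp' he)

/-- Pythagoras: the cross term vanishes because W and θ depend on the past only. -/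
lemma integral_norm_sq_add_gradNoise {S : Matrix (Fin d) (Fin d) ℝ} {c : Vec d} {θ W : Ω → Vec d}
    {Z Z₀ : Ω → Vec d × ℝ} (hm : m ≤ mΩ) (hθm : Measurable[m] θ)
    (hWm : Measurable[m] W) (hW : MemLp W 2 P) (hZ : Measurable Z) (hZ₀ : Measurable Z₀)
    (hind : Indep m (MeasurableSpace.comap Z inferInstance) P) (hid : IdentDistrib Z Z₀ P P)
    (hL2 : ∀ s, MemLp (fun ω => gradNoise S c s (Z₀ ω)) 2 P)
    (hmean : ∀ s, ∫ ω, gradNoise S c s (Z₀ ω) ∂P = 0)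
    (he : MemLp (fun ω => gradNoise S c (θ ω) (Z ω)) 2 P) (T : Vec d →L[ℝ] Vec d) (γ : ℝ) :
    ∫ ω, ‖T (W ω + γ • gradNoise S c (θ ω) (Z ω))‖ ^ 2 ∂P
      = ∫ ω, ‖T (W ω)‖ ^ 2 ∂P + γ ^ 2 * ∫ ω, ‖T (gradNoise S c (θ ω) (Z ω))‖ ^ 2 ∂P := by
  have h0 := integral_inner_gradNoise hm hθm hWm hW hZ hZ₀ hind hid hL2 hmean he T
  have hTW : MemLp (fun ω => T (W ω)) 2 P := T.comp_memLp' hW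
  have hTe : MemLp (fun ω => T (gradNoise S c (θ ω) (Z ω))) 2 P := T.comp_memLp' he
  have hi := integrable_inner_of_memLp hTW hTe
  have e : ∀ ω, ‖T (W ω + γ • gradNoise S c (θ ω) (Z ω))‖ ^ 2
      = ‖T (W ω)‖ ^ 2 + 2 * γ * inner ℝ (T (W ω)) (T (gradNoise S c (θ ω) (Z ω)))
        + γ ^ 2 * ‖T (gradNoise S c (θ ω) (Z ω))‖ ^ 2 := by
    intro ω
    rw [map_add, map_smul, norm_add_sq_real, inner_smul_right, norm_smul, mul_pow,
      Real.norm_eq_abs, sq_abs]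
    ring
  simp_rw [e]
  rw [integral_add_add (integrable_norm_sq hTW) (hi.const_mul (2 * γ))
    ((integrable_norm_sq hTe).const_mul (γ ^ 2)), integral_const_mul,
    integral_const_mul, h0]
  ring

end Noise

end DualAveraging

namespace DualAveraging

/-! ### The stochastic run and its noise-free companion. -/

section Stochastic

variable {d : ℕ} {Ω : Type*} [MeasurableSpace Ω] {P : Measure Ω}

/-- I.i.d. observations with centred, square integrable gradient noise. -/
structure IsNoiseModel (P : Measure Ω) (S : Matrix (Fin d) (Fin d) ℝ) (c : Vec d)
    (Z : ℕ → Ω → Vec d × ℝ) : Prop where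
  meas : ∀ k, Measurable (Z k)
  indep : iIndepFun Z P
  ident : ∀ k, IdentDistrib (Z k) (Z 0) P P
  memLp : ∀ s, MemLp (fun ω => gradNoise S c s (Z 0 ω)) 2 P
  mean : ∀ s, ∫ ω, gradNoise S c s (Z 0 ω) ∂P = 0

/-- A run of stochastic dual averaging, adapted to the observations and square integrable. -/
structure IsDualPath (P : Measure Ω) (h g : Vec d → EReal) (μ γ : ℝ)
    (S : Matrix (Fin d) (Fin d) ℝ) (c : Vec d) (Z : ℕ → Ω → Vec d × ℝ)
    (η θ : ℕ → Ω → Vec d) : Prop where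
  min : ∀ k ω, IsStrongMin μ (stageDom h g k) (stageFun h g γ k) (η k ω) (θ k ω)
  step : ∀ k ω, η (k + 1) ω = η k ω
    - γ • (Matrix.toEuclideanLin S (θ k ω - c) - gradNoise S c (θ k ω) (Z k ω))
  meas_dual : ∀ k, Measurable[past Z k] (η k)
  meas : ∀ k, Measurable[past Z k] (θ k)
  memLp_dual : ∀ k, MemLp (η k) 2 P
  memLp : ∀ k, MemLp (θ k) 2 P

variable {h g : Vec d → EReal} {μ γ : ℝ} {S : Matrix (Fin d) (Fin d) ℝ} {c p : Vec d}
  {Z : ℕ → Ω → Vec d × ℝ} {η θ : ℕ → Ω → Vec d}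

lemma integral_norm_sq_map_sub_le_two {u v : Ω → Vec d} (hu : MemLp u 2 P) (hv : MemLp v 2 P)
    (T : Vec d →L[ℝ] Vec d) : ∫ ω, ‖T (u ω - v ω)‖ ^ 2 ∂P
      ≤ 2 * ∫ ω, ‖T (u ω)‖ ^ 2 ∂P + 2 * ∫ ω, ‖T (v ω)‖ ^ 2 ∂P := by
  have hi : Integrable (fun ω => ‖T (u ω)‖ ^ 2) P := integrable_norm_sq (T.comp_memLp' hu)
  have hi' : Integrable (fun ω => ‖T (v ω)‖ ^ 2) P := integrable_norm_sq (T.comp_memLp' hv)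
  rw [← integral_const_mul, ← integral_const_mul, ← integral_add (hi.const_mul 2) (hi'.const_mul 2)]
  refine integral_mono (integrable_norm_sq (T.comp_memLp' (hu.sub hv)))
    ((hi.const_mul 2).add (hi'.const_mul 2)) fun ω => ?_
  simp only [map_sub]
  have := parallelogram_law_with_norm ℝ (T (u ω)) (T (v ω))
  have : 0 ≤ ‖T (u ω) + T (v ω)‖ ^ 2 := by positivity
  linarith

variable [IsProbabilityMeasure P]

lemma IsDualPath.memLp_noise (hD : IsDualPath P h g μ γ S c Z η θ) (hZ : IsNoiseModel P S c Z)
    {a b : ℝ}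
    (hab : ∀ s, ∫ ω, ‖gradNoise S c s (Z 0 ω)‖ ^ 2 ∂P ≤ a + b * mahalSq S (s - p)) (k : ℕ) :
    MemLp (fun ω => gradNoise S c (θ k ω) (Z k ω)) 2 P :=
  memLp_gradNoise (past_le hZ.meas k) (hD.meas k) (hD.memLp k) (hZ.meas k) (hZ.meas 0)
    (indep_past hZ.meas hZ.indep k) (hZ.ident k) hZ.memLp hab

lemma IsDualPath.integral_noise_le (hD : IsDualPath P h g μ γ S c Z η θ)
    (hZ : IsNoiseModel P S c Z) (T : Vec d →L[ℝ] Vec d) {a b : ℝ}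
    (hab : ∀ s, ∫ ω, ‖T (gradNoise S c s (Z 0 ω))‖ ^ 2 ∂P ≤ a + b * mahalSq S (s - p)) (k : ℕ) :
    ∫ ω, ‖T (gradNoise S c (θ k ω) (Z k ω))‖ ^ 2 ∂P ≤ a + b * ∫ ω, mahalSq S (θ k ω - p) ∂P :=
  (integral_gradNoise_le (past_le hZ.meas k) (hD.meas k) (hD.memLp k) (hZ.meas k) (hZ.meas 0)
    (indep_past hZ.meas hZ.indep k) (hZ.ident k) hZ.memLp T hab).2

/-- The expected sum of the squared distances of the iterates to `p`. -/
theorem IsDualPath.sum_integral_mahalSq_le (hD : IsDualPath P h g μ γ S c Z η θ)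
    (hZ : IsNoiseModel P S c Z) (hμ : 0 < μ) (hγ : 0 < γ)
    (hL : (Matrix.toEuclideanLin S).IsSymmetric)
    (hLμ : ∀ v, γ * mahalSq S v ≤ μ / 4 * ‖v‖ ^ 2)
    (hp : p ∈ effDom h ∩ effDom g)
    (hopt : ∀ z ∈ effDom h ∩ effDom g,
      0 ≤ inner ℝ (Matrix.toEuclideanLin S (p - c)) (z - p) + (g z).toReal - (g p).toReal)
    {a b D : ℝ}
    (hab : ∀ s, ∫ ω, ‖gradNoise S c s (Z 0 ω)‖ ^ 2 ∂P ≤ a + b * mahalSq S (s - p))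
    (hb : 2 / 3 * γ ^ 2 / μ * b ≤ γ / 2)
    (h0 : ∀ ω, dualGap (stageFun h g γ 0) p (η 0 ω) (θ 0 ω) = D)
    (hS : ∀ v, 0 ≤ mahalSq S v) (n : ℕ) :
    γ / 2 * ∑ k ∈ Finset.range n, ∫ ω, mahalSq S (θ (k + 1) ω - p) ∂P
      ≤ D + n * (2 / 3 * γ ^ 2 / μ * a) := by
  have hq : ∀ k, Integrable (fun ω => mahalSq S (θ k ω - p)) P := fun k =>
    integrable_mahalSq S ((hD.memLp k).sub (memLp_const p))
  have he := fun k => hD.memLp_noise hZ hab k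
  have hen : ∀ k, Integrable (fun ω => ‖gradNoise S c (θ k ω) (Z k ω)‖ ^ 2) P := fun k =>
    integrable_norm_sq (he k)
  have hei : ∀ k, Integrable
      (fun ω => (inner ℝ (gradNoise S c (θ k ω) (Z k ω)) (θ k ω - p) : ℝ)) P := fun k =>
    integrable_inner_of_memLp (he k) ((hD.memLp k).sub (memLp_const p))
  have hzero : ∀ k, ∫ ω, (inner ℝ (gradNoise S c (θ k ω) (Z k ω)) (θ k ω - p) : ℝ) ∂P = 0 := by
    intro k
    have := integral_inner_gradNoise (past_le hZ.meas k) (hD.meas k)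
      (W := fun ω => θ k ω - p) ((hD.meas k).sub measurable_const)
      ((hD.memLp k).sub (memLp_const p)) (hZ.meas k) (hZ.meas 0)
      (indep_past hZ.meas hZ.indep k) (hZ.ident k) hZ.memLp hZ.mean (he k)
      (ContinuousLinearMap.id ℝ (Vec d))
    simp_rw [real_inner_comm (θ k _ - p)]
    exact this
  have hpt : ∀ ω, ∑ k ∈ Finset.range n, (γ / 2 * mahalSq S (θ k ω - p)
        + γ / 2 * mahalSq S (θ (k + 1) ω - p))
      ≤ D + ∑ k ∈ Finset.range n,
          (γ * inner ℝ (gradNoise S c (θ k ω) (Z k ω)) (θ k ω - p)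
            + 2 / 3 * γ ^ 2 / μ * ‖gradNoise S c (θ k ω) (Z k ω)‖ ^ 2) := by
    intro ω
    have := sum_dualAveraging_le hμ hγ hL hLμ hp hopt (fun k => hD.min k ω)
      (fun k => hD.step k ω) n
    rw [h0 ω] at this
    exact this
  have hi1 : ∀ k, Integrable (fun ω => γ / 2 * mahalSq S (θ k ω - p)
        + γ / 2 * mahalSq S (θ (k + 1) ω - p)) P := fun k =>
    ((hq k).const_mul _).add ((hq (k + 1)).const_mul _)
  have hi2 : ∀ k, Integrable (fun ω => γ * inner ℝ (gradNoise S c (θ k ω) (Z k ω)) (θ k ω - p)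
            + 2 / 3 * γ ^ 2 / μ * ‖gradNoise S c (θ k ω) (Z k ω)‖ ^ 2) P := fun k =>
    ((hei k).const_mul _).add ((hen k).const_mul _)
  have hint := integral_mono (integrable_finsetSum _ fun k _ => hi1 k)
    ((integrable_const D).add (integrable_finsetSum _ fun k _ => hi2 k)) hpt
  rw [integral_finsetSum _ fun k _ => hi1 k,
    integral_add' (integrable_const D) (integrable_finsetSum _ fun k _ => hi2 k),
    integral_finsetSum _ fun k _ => hi2 k, integral_const] at hint
  simp only [probReal_univ, smul_eq_mul, one_mul] at hint
  have e1 : ∀ k, ∫ ω, (γ / 2 * mahalSq S (θ k ω - p) + γ / 2 * mahalSq S (θ (k + 1) ω - p)) ∂P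
      = γ / 2 * ∫ ω, mahalSq S (θ k ω - p) ∂P
        + γ / 2 * ∫ ω, mahalSq S (θ (k + 1) ω - p) ∂P := fun k => by
    rw [integral_add ((hq k).const_mul _) ((hq (k + 1)).const_mul _), integral_const_mul,
      integral_const_mul]
  -- The centred term drops out, and by `hb` the error-dependent part of the noise is at most the
  -- half of the squared error at θ k available on the left. After cancellation only the errors at θ
  -- (k + 1) remain.
  have e2 : ∀ k, ∫ ω, (γ * inner ℝ (gradNoise S c (θ k ω) (Z k ω)) (θ k ω - p)
            + 2 / 3 * γ ^ 2 / μ * ‖gradNoise S c (θ k ω) (Z k ω)‖ ^ 2) ∂P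
      ≤ 2 / 3 * γ ^ 2 / μ * a + γ / 2 * ∫ ω, mahalSq S (θ k ω - p) ∂P := fun k => by
    rw [integral_add ((hei k).const_mul _) ((hen k).const_mul _), integral_const_mul,
      integral_const_mul, hzero, mul_zero, zero_add]
    have h1 := hD.integral_noise_le hZ (ContinuousLinearMap.id ℝ (Vec d)) hab k
    have h2 : 0 ≤ ∫ ω, mahalSq S (θ k ω - p) ∂P := integral_nonneg fun ω => hS _
    have h3 := mul_le_mul_of_nonneg_right hb h2
    have h4 := mul_le_mul_of_nonneg_left h1 (show 0 ≤ 2 / 3 * γ ^ 2 / μ by positivity)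
    refine h4.trans ?_
    linarith
  simp_rw [e1] at hint
  have hsum := Finset.sum_le_sum fun k (_ : k ∈ Finset.range n) => e2 k
  rw [Finset.sum_add_distrib] at hint hsum
  rw [Finset.sum_const, Finset.card_range, nsmul_eq_mul] at hsum
  rw [Finset.mul_sum]
  linarith

/-- Second moment of a contracted sequence driven by the gradient noise. -/
lemma IsDualPath.integral_norm_sq_le_sum (hD : IsDualPath P h g μ γ S c Z η θ)
    (hZ : IsNoiseModel P S c Z) {a b : ℝ}
    (hab : ∀ s, ∫ ω, ‖gradNoise S c s (Z 0 ω)‖ ^ 2 ∂P ≤ a + b * mahalSq S (s - p))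
    (T : Vec d →L[ℝ] Vec d) {W V : ℕ → Ω → Vec d} (hW0 : ∀ ω, W 0 ω = 0)
    (hW : ∀ k ω, W (k + 1) ω = V k ω + γ • gradNoise S c (θ k ω) (Z k ω))
    (hVW : ∀ k ω, ‖T (V k ω)‖ ^ 2 ≤ ‖T (W k ω)‖ ^ 2)
    (hVm : ∀ k, Measurable[past Z k] (V k)) (hV2 : ∀ k, MemLp (V k) 2 P)
    (hW2 : ∀ k, MemLp (W k) 2 P) (n : ℕ) :
    ∫ ω, ‖T (W n ω)‖ ^ 2 ∂P
      ≤ γ ^ 2 * ∑ k ∈ Finset.range n, ∫ ω, ‖T (gradNoise S c (θ k ω) (Z k ω))‖ ^ 2 ∂P := by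
  induction n with
  | zero => simp [hW0]
  | succ n ih =>
    simp_rw [hW]
    rw [integral_norm_sq_add_gradNoise (past_le hZ.meas n) (hD.meas n) (hVm n) (hV2 n)
      (hZ.meas n) (hZ.meas 0) (indep_past hZ.meas hZ.indep n) (hZ.ident n) hZ.memLp hZ.mean
      (hD.memLp_noise hZ hab n) T γ, Finset.sum_range_succ, mul_add]
    gcongr
    exact (integral_mono (integrable_norm_sq (T.comp_memLp' (hV2 n)))
      (integrable_norm_sq (T.comp_memLp' (hW2 n))) (hVW n)).trans ih

/-- The stochastic run stays close to the noise-free run `(ω, φ)`. -/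
theorem IsDualPath.integral_mahalSq_sum_sub_le (hD : IsDualPath P h g μ γ S c Z η θ)
    (hZ : IsNoiseModel P S c Z) (hμ : 0 < μ) (hγ : 0 < γ)
    (hLμ : ∀ v, γ * mahalSq S v ≤ μ / 4 * ‖v‖ ^ 2) {a b : ℝ}
    (hab : ∀ s, ∫ ω, ‖gradNoise S c s (Z 0 ω)‖ ^ 2 ∂P ≤ a + b * mahalSq S (s - p))
    {B : Vec d →L[ℝ] Vec d}
    (hB : ∀ u w, inner ℝ (B u) (B (Matrix.toEuclideanLin S w)) = (inner ℝ u w : ℝ))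
    {ν φ : ℕ → Vec d}
    (hφ : ∀ k, IsStrongMin μ (stageDom h g k) (stageFun h g γ k) (ν k) (φ k))
    (hν : ∀ k, ν (k + 1) = ν k - γ • Matrix.toEuclideanLin S (φ k - c))
    (h0 : ∀ ω, η 0 ω = ν 0) (n : ℕ) :
    ∫ ω, mahalSq S (∑ k ∈ Finset.range n, (θ k ω - φ k)) ∂P
      ≤ 4 * ∑ k ∈ Finset.range n, ∫ ω, ‖B (gradNoise S c (θ k ω) (Z k ω))‖ ^ 2 ∂P := by
  set L := Matrix.toEuclideanLin S with hLdef
  have hq : ∀ v, mahalSq S v = ‖B (L v)‖ ^ 2 := by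
    intro v
    rw [← real_inner_self_eq_norm_sq, hB, real_inner_comm]
    rfl
  have he := fun k => hD.memLp_noise hZ hab k
  have hmem : ∀ k, MemLp (fun ω => θ k ω - φ k) 2 P := fun k =>
    (hD.memLp k).sub (memLp_const _)
  set N : ℕ → Ω → Vec d := fun n ω =>
    ∑ k ∈ Finset.range n, γ • gradNoise S c (θ k ω) (Z k ω) with hN
  set W : ℕ → Ω → Vec d := fun n ω => η n ω - ν n with hWdef
  have hN2 : ∀ k, MemLp (N k) 2 P := fun k =>
    memLp_finsetSum _ fun i _ => (he i).const_smul γ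
  have hW2 : ∀ k, MemLp (W k) 2 P := fun k => (hD.memLp_dual k).sub (memLp_const _)
  have hWstep : ∀ k ω, W (k + 1) ω
      = (W k ω - γ • L (θ k ω - φ k)) + γ • gradNoise S c (θ k ω) (Z k ω) := by
    intro k ω
    have : L (θ k ω - φ k) = L (θ k ω - c) - L (φ k - c) := by
      rw [← map_sub, sub_sub_sub_cancel_right]
    simp only [hWdef]
    rw [hD.step, hν, this]
    module
  -- Summing the recursion for W expresses the accumulated primal difference by two dual quantities,
  -- each driven by the same noise: the plain sum N and the contracted sequence W.
  have hsum : ∀ n ω, γ • L (∑ k ∈ Finset.range n, (θ k ω - φ k)) = N n ω - W n ω := by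
    intro n ω
    induction n with
    | zero => simp [hN, hWdef, h0]
    | succ n ih =>
      rw [Finset.sum_range_succ, map_add, smul_add, ih, hWstep]
      simp only [hN, Finset.sum_range_succ]
      module
  have hmeasN : ∀ k, Measurable[past Z k] (N k) := by
    intro k
    induction k with
    | zero => simp only [hN, Finset.range_zero, Finset.sum_empty]; exact measurable_const
    | succ k ih =>
      have e : N (k + 1) = fun ω => N k ω + γ • gradNoise S c (θ k ω) (Z k ω) := by
        funext ω
        simp only [hN, Finset.sum_range_succ]
      rw [e]
      refine (ih.mono (past_mono Z k) le_rfl).add ?_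
      refine Measurable.const_smul ?_ γ
      exact measurable_gradNoise_comp S c ((hD.meas k).mono (past_mono Z k) le_rfl)
        (measurable_past_succ Z k)
  have b1 := hD.integral_norm_sq_le_sum hZ hab B (W := N) (V := N) (fun ω => by simp [hN])
    (fun k ω => by simp only [hN, Finset.sum_range_succ]) (fun k ω => le_rfl) hmeasN hN2 hN2 n
  have hLm : Measurable L := (continuous_toEuclideanLin S).measurable
  have b2 := hD.integral_norm_sq_le_sum hZ hab B (W := W)
    (V := fun k ω => W k ω - γ • L (θ k ω - φ k)) (fun ω => by simp [hWdef, h0]) hWstep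
    -- The drift is nonexpansive: whitening turns the cross term into ⟨W, θ - φ⟩ ≥ μ‖θ - φ‖² by
    -- strong monotonicity, and γS ≤ μ/4 controls the square γ²‖θ - φ‖_S².
    (fun k ω => by
      have m1 := (hD.min k ω).mono_inner (hφ k)
      have m2 := hLμ (θ k ω - φ k)
      have m3 := mul_le_mul_of_nonneg_left m2 hγ.le
      have m4 := mul_le_mul_of_nonneg_left m1 hγ.le
      have m5 : 0 ≤ γ * (μ * ‖θ k ω - φ k‖ ^ 2) := by positivity
      rw [map_sub, map_smul, norm_sub_sq_real, inner_smul_right, hB, norm_smul, mul_pow, ← hq,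
        Real.norm_eq_abs, sq_abs]
      simp only [hWdef]
      nlinarith)
    (fun k => ((hD.meas_dual k).sub measurable_const).sub
      ((hLm.comp ((hD.meas k).sub measurable_const)).const_smul γ))
    (fun k => (hW2 k).sub ((memLp_toEuclideanLin S (hmem k)).const_smul γ)) hW2 n
  have b3 := integral_norm_sq_map_sub_le_two (hN2 n) (hW2 n) B
  have e : ∫ ω, ‖B (N n ω - W n ω)‖ ^ 2 ∂P
      = γ ^ 2 * ∫ ω, mahalSq S (∑ k ∈ Finset.range n, (θ k ω - φ k)) ∂P := by
    rw [← integral_const_mul]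
    congr 1
    funext ω
    rw [← hsum, map_smul, norm_smul, mul_pow, hq, Real.norm_eq_abs, sq_abs]
  rw [e] at b3
  have hγ2 : 0 < γ ^ 2 := by positivity
  refine le_of_mul_le_mul_left ?_ hγ2
  linarith

lemma mahalSq_add_le (hS : ∀ v, 0 ≤ mahalSq S v) (u v : Vec d) :
    mahalSq S (u + v) ≤ 2 * mahalSq S u + 2 * mahalSq S v := by
  have := hS (u - v)
  simp only [mahalSq, map_add, map_sub, inner_add_left, inner_add_right, inner_sub_left,
    inner_sub_right] at this ⊢
  linarith

lemma mahalSq_sum_le {B : Vec d →L[ℝ] Vec d}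
    (hB : ∀ v, mahalSq S v = ‖B (Matrix.toEuclideanLin S v)‖ ^ 2) (v : ℕ → Vec d) (n : ℕ) :
    mahalSq S (∑ k ∈ Finset.range n, v k) ≤ n * ∑ k ∈ Finset.range n, mahalSq S (v k) := by
  simp_rw [hB, map_sum]
  calc ‖∑ k ∈ Finset.range n, B (Matrix.toEuclideanLin S (v k))‖ ^ 2
      ≤ (∑ k ∈ Finset.range n, ‖B (Matrix.toEuclideanLin S (v k))‖) ^ 2 := by
        gcongr; exact norm_sum_le _ _
    _ ≤ _ := by
        have := sq_sum_le_card_mul_sum_sq (s := Finset.range n)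
          (f := fun k => ‖B (Matrix.toEuclideanLin S (v k))‖)
        simpa using this

/-- The excess error of averaged stochastic dual averaging. -/
theorem IsDualPath.half_integral_mahalSq_average_le (hD : IsDualPath P h g μ γ S c Z η θ)
    (hZ : IsNoiseModel P S c Z) (hμ : 0 < μ) (hγ : 0 < γ)
    (hL : (Matrix.toEuclideanLin S).IsSymmetric) (hS : ∀ v, 0 ≤ mahalSq S v)
    (hLμ : ∀ v, γ * mahalSq S v ≤ μ / 4 * ‖v‖ ^ 2)
    (hp : p ∈ effDom h ∩ effDom g)
    (hopt : ∀ z ∈ effDom h ∩ effDom g,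
      0 ≤ inner ℝ (Matrix.toEuclideanLin S (p - c)) (z - p) + (g z).toReal - (g p).toReal)
    {a b a' b' D : ℝ} (hb' : 0 ≤ b')
    (hab : ∀ s, ∫ ω, ‖gradNoise S c s (Z 0 ω)‖ ^ 2 ∂P ≤ a + b * mahalSq S (s - p))
    (hb : 2 / 3 * γ ^ 2 / μ * b ≤ γ / 2)
    {B : Vec d →L[ℝ] Vec d}
    (hB : ∀ u w, inner ℝ (B u) (B (Matrix.toEuclideanLin S w)) = (inner ℝ u w : ℝ))
    (hab' : ∀ s, ∫ ω, ‖B (gradNoise S c s (Z 0 ω))‖ ^ 2 ∂P ≤ a' + b' * mahalSq S (s - p))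
    {ν φ : ℕ → Vec d}
    (hφ : ∀ k, IsStrongMin μ (stageDom h g k) (stageFun h g γ k) (ν k) (φ k))
    (hν : ∀ k, ν (k + 1) = ν k - γ • Matrix.toEuclideanLin S (φ k - c))
    (h0 : ∀ ω, η 0 ω = ν 0) (h0' : ∀ ω, θ 0 ω = φ 0)
    (hDφ : dualGap (stageFun h g γ 0) p (ν 0) (φ 0) = D) {n : ℕ} (hn : 1 ≤ n) :
    1 / 2 * ∫ ω, mahalSq S ((n : ℝ)⁻¹ • ∑ k ∈ Finset.range n, θ k ω - p) ∂P
      ≤ 2 * D / (γ * n) + 4 / (n : ℝ) ^ 2 * (n * a' + b' * (mahalSq S (φ 0 - p) + 2 * D / γ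
        + n * (4 / 3 * γ / μ * a))) := by
  have hn0 : (0 : ℝ) < n := by exact_mod_cast hn
  have hBq : ∀ v, mahalSq S v = ‖B (Matrix.toEuclideanLin S v)‖ ^ 2 := by
    intro v
    rw [← real_inner_self_eq_norm_sq, hB, real_inner_comm]
    rfl
  -- the noise-free run
  have hdet : ∑ k ∈ Finset.range n, mahalSq S (φ k - p) ≤ 2 * D / γ := by
    have h1 := sum_dualAveraging_le (e := fun _ => 0) hμ hγ hL hLμ hp hopt hφ
      (fun k => by rw [sub_zero]; exact hν k) n
    rw [hDφ] at h1
    simp only [inner_zero_left, mul_zero, norm_zero, ne_eq, OfNat.ofNat_ne_zero,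
      not_false_eq_true, zero_pow, add_zero, Finset.sum_const_zero] at h1
    have h2 : ∑ k ∈ Finset.range n, γ / 2 * mahalSq S (φ k - p) ≤ D := by
      refine le_trans (Finset.sum_le_sum fun k _ => ?_) h1
      have : 0 ≤ γ / 2 * mahalSq S (φ (k + 1) - p) := mul_nonneg (by positivity) (hS _)
      exact le_add_of_nonneg_right this
    rw [← Finset.mul_sum] at h2
    rw [le_div_iff₀ hγ]
    linarith
  have hdet' := mahalSq_sum_le hBq (fun k => φ k - p) n
  -- the stochastic run
  have hA := hD.sum_integral_mahalSq_le hZ hμ hγ hL hLμ hp hopt hab hb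
    (fun ω => by rw [h0, h0', hDφ]) hS n
  set A : ℕ → ℝ := fun k => ∫ ω, mahalSq S (θ k ω - p) ∂P with hAdef
  have hAnn : ∀ k, 0 ≤ A k := fun k => integral_nonneg fun ω => hS _
  have hA0 : A 0 = mahalSq S (φ 0 - p) := by
    simp only [hAdef, h0']
    simp
  have hAsum : ∑ k ∈ Finset.range n, A k
      ≤ mahalSq S (φ 0 - p) + 2 * D / γ + n * (4 / 3 * γ / μ * a) := by
    -- The Lyapunov estimate controls A 1, …, A n, whereas the average involves A 0, …, A (n - 1);
    -- hence the separate initial term.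
    have h1 : ∑ k ∈ Finset.range n, A k ≤ ∑ k ∈ Finset.range (n + 1), A k :=
      Finset.sum_le_sum_of_subset_of_nonneg (by simp) fun k _ _ => hAnn k
    rw [Finset.sum_range_succ', hA0] at h1
    have h2 : ∑ k ∈ Finset.range n, A (k + 1) ≤ 2 * D / γ + n * (4 / 3 * γ / μ * a) := by
      have h3 : 2 * D / γ + n * (4 / 3 * γ / μ * a)
          = 2 / γ * (D + n * (2 / 3 * γ ^ 2 / μ * a)) := by
        field_simp
        ring
      rw [h3]
      calc ∑ k ∈ Finset.range n, A (k + 1)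
          = 2 / γ * (γ / 2 * ∑ k ∈ Finset.range n, A (k + 1)) := by field_simp
        _ ≤ _ := by gcongr
    linarith
  have hE : ∑ k ∈ Finset.range n, ∫ ω, ‖B (gradNoise S c (θ k ω) (Z k ω))‖ ^ 2 ∂P
      ≤ n * a' + b' * ∑ k ∈ Finset.range n, A k := by
    refine (Finset.sum_le_sum fun k _ => hD.integral_noise_le hZ B hab' k).trans (le_of_eq ?_)
    rw [Finset.sum_add_distrib, Finset.sum_const, Finset.card_range, nsmul_eq_mul,
      ← Finset.mul_sum]
  have hclose := hD.integral_mahalSq_sum_sub_le hZ hμ hγ hLμ hab hB hφ hν h0 n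
  -- combination
  have hmem : MemLp (fun ω => ∑ k ∈ Finset.range n, (θ k ω - φ k)) 2 P :=
    memLp_finsetSum _ fun k _ => (hD.memLp k).sub (memLp_const _)
  have hi := integrable_mahalSq S hmem
  have hsum : MemLp (fun ω => ∑ k ∈ Finset.range n, θ k ω) 2 P :=
    memLp_finsetSum _ fun k _ => hD.memLp k
  have hmem' : MemLp (fun ω => (n : ℝ)⁻¹ • ∑ k ∈ Finset.range n, θ k ω - p) 2 P :=
    (hsum.const_smul (n : ℝ)⁻¹).sub (memLp_const p)
  have hpt : ∀ ω, mahalSq S ((n : ℝ)⁻¹ • ∑ k ∈ Finset.range n, θ k ω - p)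
      ≤ 2 / (n : ℝ) ^ 2 * mahalSq S (∑ k ∈ Finset.range n, (θ k ω - φ k))
        + 2 / (n : ℝ) ^ 2 * mahalSq S (∑ k ∈ Finset.range n, (φ k - p)) := by
    intro ω
    have e : (n : ℝ)⁻¹ • ∑ k ∈ Finset.range n, θ k ω - p
        = (n : ℝ)⁻¹ • (∑ k ∈ Finset.range n, (θ k ω - φ k)
          + ∑ k ∈ Finset.range n, (φ k - p)) := by
      rw [← Finset.sum_add_distrib]
      simp only [sub_add_sub_cancel]
      rw [Finset.sum_sub_distrib, Finset.sum_const, Finset.card_range, smul_sub,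
        ← Nat.cast_smul_eq_nsmul ℝ, smul_smul, inv_mul_cancel₀ hn0.ne', one_smul]
    rw [e, mahalSq_smul]
    have := mahalSq_add_le hS (∑ k ∈ Finset.range n, (θ k ω - φ k))
      (∑ k ∈ Finset.range n, (φ k - p))
    have h2 := mul_le_mul_of_nonneg_left this (show 0 ≤ ((n : ℝ)⁻¹) ^ 2 by positivity)
    refine h2.trans (le_of_eq ?_)
    field_simp
  have hint := integral_mono (integrable_mahalSq S hmem')
    ((hi.const_mul _).add (integrable_const _)) hpt
  rw [integral_add' (hi.const_mul _) (integrable_const _), integral_const_mul,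
    integral_const] at hint
  simp only [probReal_univ, smul_eq_mul, one_mul] at hint
  have f1 : mahalSq S (∑ k ∈ Finset.range n, (φ k - p)) ≤ n * (2 * D / γ) :=
    hdet'.trans (by gcongr)
  have f2 : ∫ ω, mahalSq S (∑ k ∈ Finset.range n, (θ k ω - φ k)) ∂P
      ≤ 4 * (n * a' + b' * (mahalSq S (φ 0 - p) + 2 * D / γ + n * (4 / 3 * γ / μ * a))) := by
    refine hclose.trans ?_
    gcongr
    refine hE.trans ?_
    gcongr
  calc 1 / 2 * ∫ ω, mahalSq S ((n : ℝ)⁻¹ • ∑ k ∈ Finset.range n, θ k ω - p) ∂P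
      ≤ 1 / 2 * (2 / (n : ℝ) ^ 2 * (4 * (n * a' + b' * (mahalSq S (φ 0 - p) + 2 * D / γ
          + n * (4 / 3 * γ / μ * a)))) + 2 / (n : ℝ) ^ 2 * (n * (2 * D / γ))) := by
        refine mul_le_mul_of_nonneg_left (hint.trans ?_) (by norm_num)
        gcongr
    _ = _ := by
        field_simp
        ring

end Stochastic

end DualAveraging

namespace DualAveraging

/-! ### Verification of the model assumptions and constants. -/

section Assembly

variable {d : ℕ} {Ω : Type*} [MeasurableSpace Ω] {P : Measure Ω}
  {h g : Vec d → EReal} {μ γ : ℝ} {S : Matrix (Fin d) (Fin d) ℝ} {c p : Vec d}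

lemma isStrongMin_stage_zero (hh : IsLegendre h)
    (hstrong : ConvexOn ℝ (effDom h) (fun θ => (h θ).toReal - μ / 2 * ‖θ‖ ^ 2))
    (g : Vec d → EReal) (γ : ℝ) {θ₀ : Vec d} (hθ₀ : θ₀ ∈ interior (effDom h)) :
    IsStrongMin μ (stageDom h g 0) (stageFun h g γ 0) (egrad h θ₀) θ₀ := by
  have e : stageFun h g γ 0 = fun z => (h z).toReal := by
    funext z
    simp [stageFun]
  rw [e]
  exact StrongConvexOn.isStrongMin_gradient (strongConvexOn_iff_convex.2 hstrong)
    (interior_subset hθ₀) (hh.differentiableAt θ₀ hθ₀)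

/-- The noise-free run of dual averaging. -/
lemma exists_noiseFree_run {T : ℕ → Vec d → Vec d}
    (hT : ∀ k η, IsStrongMin μ (stageDom h g (k + 1)) (stageFun h g γ (k + 1)) η (T k η))
    {η₀ θ₀ : Vec d} (h0 : IsStrongMin μ (stageDom h g 0) (stageFun h g γ 0) η₀ θ₀)
    (v : Vec d → Vec d) :
    ∃ ν φ : ℕ → Vec d, ν 0 = η₀ ∧ φ 0 = θ₀ ∧ (∀ k, ν (k + 1) = ν k - γ • v (φ k)) ∧
      ∀ k, IsStrongMin μ (stageDom h g k) (stageFun h g γ k) (ν k) (φ k) := by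
  let s : ℕ → Vec d × Vec d := fun k => Nat.rec (η₀, θ₀)
    (fun k s => (s.1 - γ • v s.2, T k (s.1 - γ • v s.2))) k
  refine ⟨fun k => (s k).1, fun k => (s k).2, rfl, rfl, fun k => rfl, fun k => ?_⟩
  cases k with
  | zero => exact h0
  | succ k => exact hT k _

lemma continuous_of_isStrongMin {C : Set (Vec d)} {F : Vec d → ℝ} (hμ : 0 < μ)
    {T : Vec d → Vec d} (hT : ∀ η, IsStrongMin μ C F η (T η)) : Continuous T := by
  have : LipschitzWith (Real.toNNReal μ⁻¹) T := by
    refine LipschitzWith.of_dist_le_mul fun a b => ?_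
    rw [dist_eq_norm, dist_eq_norm, Real.coe_toNNReal _ (by positivity)]
    exact (hT a).norm_sub_le hμ (hT b)
  exact this.continuous

lemma memLp_of_isStrongMin [IsProbabilityMeasure P] {C : Set (Vec d)} {F : Vec d → ℝ} (hμ : 0 < μ)
    {T : Vec d → Vec d} (hT : ∀ η, IsStrongMin μ C F η (T η)) {η : Ω → Vec d}
    (hη : MemLp η 2 P) : MemLp (fun ω => T (η ω)) 2 P := by
  have h1 : MemLp (fun ω => T (η ω) - T 0) 2 P := by
    refine MemLp.of_le_mul (c := μ⁻¹) hη ?_ (Eventually.of_forall fun ω => ?_)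
    · exact ((continuous_of_isStrongMin hμ hT).comp_aestronglyMeasurable
        hη.aestronglyMeasurable).sub aestronglyMeasurable_const
    · simpa using (hT (η ω)).norm_sub_le hμ (hT 0)
  have h2 := h1.add (memLp_const (μ := P) (T 0))
  refine h2.ae_eq (Eventually.of_forall fun ω => ?_)
  simp

/-- Adaptedness and square integrability propagate together by induction: the noise at θ k is square
integrable once θ k is, and the primal map is Lipschitz, hence measurable and of linear growth. -/
theorem isDualPath_sda [IsProbabilityMeasure P] (hh : IsLegendre h)
    (hg : IsProperLscConvex g) (hg0 : ∀ z, 0 ≤ g z)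
    (hdom : (interior (effDom h) ∩ effDom g).Nonempty) (hμ : 0 < μ) (hγ : 0 < γ)
    (hstrong : ConvexOn ℝ (effDom h) (fun θ => (h θ).toReal - μ / 2 * ‖θ‖ ^ 2))
    {θ₀ : Vec d} (hθ₀ : θ₀ ∈ interior (effDom h)) {x : ℕ → Ω → Vec d} {y : ℕ → Ω → ℝ}
    (hZ : IsNoiseModel P S c (fun k ω => (x k ω, y k ω))) {a b : ℝ}
    (hab : ∀ s, ∫ ω, ‖gradNoise S c s (x 0 ω, y 0 ω)‖ ^ 2 ∂P ≤ a + b * mahalSq S (s - p)) :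
    IsDualPath P h g μ γ S c (fun k ω => (x k ω, y k ω))
      (fun k ω => (sda h g γ θ₀ (fun k => x k ω) (fun k => y k ω) k).1)
      (fun k ω => (sda h g γ θ₀ (fun k => x k ω) (fun k => y k ω) k).2) := by
  set Z : ℕ → Ω → Vec d × ℝ := fun k ω => (x k ω, y k ω) with hZdef
  set η : ℕ → Ω → Vec d := fun k ω => (sda h g γ θ₀ (fun k => x k ω) (fun k => y k ω) k).1
  set θ : ℕ → Ω → Vec d := fun k ω => (sda h g γ θ₀ (fun k => x k ω) (fun k => y k ω) k).2
  have hT := isStrongMin_egrad_conj hh hg hg0 hdom hμ hγ hstrong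
  have hη : ∀ k, η (k + 1) = fun ω => η k ω
      - γ • (Matrix.toEuclideanLin S (θ k ω - c) - gradNoise S c (θ k ω) (Z k ω)) := by
    intro k
    funext ω
    rw [gradNoise, sub_sub_cancel]
    rfl
  have hθ : ∀ k, θ (k + 1) = fun ω => egrad (conj (mirrorReg h g γ (k + 1))) (η (k + 1) ω) :=
    fun k => rfl
  have hmeas : ∀ k, Measurable[past Z k] (η k) ∧ Measurable[past Z k] (θ k) := by
    intro k
    induction k with
    | zero => exact ⟨measurable_const, measurable_const⟩
    | succ k ih =>
      have i1 := ih.1.mono (past_mono Z k) le_rfl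
      have i2 := ih.2.mono (past_mono Z k) le_rfl
      have j1 : Measurable[past Z (k + 1)] (η (k + 1)) := by
        rw [hη]
        refine i1.sub (Measurable.const_smul ?_ γ)
        exact ((continuous_toEuclideanLin S).measurable.comp (i2.sub measurable_const)).sub
          (measurable_gradNoise_comp S c i2 (measurable_past_succ Z k))
      refine ⟨j1, ?_⟩
      rw [hθ]
      exact (continuous_of_isStrongMin hμ (hT k)).measurable.comp j1
  have hmem : ∀ k, MemLp (η k) 2 P ∧ MemLp (θ k) 2 P := by
    intro k
    induction k with
    | zero => exact ⟨memLp_const _, memLp_const _⟩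
    | succ k ih =>
      have he : MemLp (fun ω => gradNoise S c (θ k ω) (Z k ω)) 2 P :=
        memLp_gradNoise (past_le hZ.meas k) (hmeas k).2 ih.2 (hZ.meas k) (hZ.meas 0)
          (indep_past hZ.meas hZ.indep k) (hZ.ident k) hZ.memLp hab
      have j1 : MemLp (η (k + 1)) 2 P := by
        rw [hη]
        have l1 := memLp_toEuclideanLin S (ih.2.sub (memLp_const c))
        exact ih.1.sub ((l1.sub he).const_smul γ)
      refine ⟨j1, ?_⟩
      rw [hθ]
      exact memLp_of_isStrongMin hμ (hT k) j1
  refine ⟨fun k ω => ?_, fun k ω => congrFun (hη k) ω, fun k => (hmeas k).1, fun k => (hmeas k).2,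
    fun k => (hmem k).1, fun k => (hmem k).2⟩
  cases k with
  | zero => exact isStrongMin_stage_zero hh hstrong g γ hθ₀
  | succ k => exact hT k _

lemma isNoiseModel_of_iid [IsProbabilityMeasure P] {x : ℕ → Ω → Vec d} {y : ℕ → Ω → ℝ}
    (hx : ∀ n, Measurable (x n)) (hy : ∀ n, Measurable (y n))
    (hindep : iIndepFun (fun n ω => (x n ω, y n ω)) P)
    (hident : ∀ n, IdentDistrib (fun ω => (x n ω, y n ω)) (fun ω => (x 0 ω, y 0 ω)) P P)
    (hx4 : MemLp (x 0) 4 P) (hy2 : MemLp (y 0) 2 P)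
    (hξ2 : MemLp (lsResidual (x 0) (y 0) c) 2 P)
    (hc : ∀ θ, lsRisk P (x 0) (y 0) c ≤ lsRisk P (x 0) (y 0) θ) :
    IsNoiseModel P (secondMoment P (x 0)) c (fun k ω => (x k ω, y k ω)) where
  meas k := (hx k).prodMk (hy k)
  indep := hindep
  ident := hident
  memLp s := (memLp_const _).sub (memLp_lsGrad hx4 hξ2 s)
  mean s := by
    simp only [gradNoise]
    rw [integral_sub (integrable_const _) ((memLp_lsGrad hx4 hξ2 s).integrable (by norm_num)),
      integral_lsGrad hx4 hy2 hξ2 hc]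
    simp

/-- Bound on the Euclidean norm of the gradient noise. -/
lemma integral_norm_gradNoise_le [IsProbabilityMeasure P] {x : Ω → Vec d} {y : Ω → ℝ}
    (hx : MemLp x 4 P) (hy : MemLp y 2 P) (hξ2 : MemLp (lsResidual x y c) 2 P)
    (hc : ∀ θ, lsRisk P x y c ≤ lsRisk P x y θ) {σ R : ℝ}
    (hξ : (σ ^ 2 • secondMoment P x - secondMoment P (lsResidual x y c)).PosSemidef)
    (hR : (R ^ 2 • secondMoment P x - secondMoment P (fun ω => ‖x ω‖ • x ω)).PosSemidef)
    (p s : Vec d) :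
    ∫ ω, ‖gradNoise (secondMoment P x) c s (x ω, y ω)‖ ^ 2 ∂P
      ≤ 3 * R ^ 2 * (σ ^ 2 + mahalSq (secondMoment P x) (p - c))
        + 3 * R ^ 2 * mahalSq (secondMoment P x) (s - p) := by
  have hx2 : MemLp x 2 P := hx.mono_exponent (by norm_num)
  have hw : MemLp (fun ω => ‖x ω‖ • x ω) 2 P := memLp_two_smul hx.norm hx
  have ha : ∫ ω, ‖lsResidual x y c ω‖ ^ 2 ∂P ≤ σ ^ 2 * R ^ 2 :=
    (integral_norm_sq_le hx2 hξ2 hξ).trans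
      (mul_le_mul_of_nonneg_left (integral_norm_sq_le_of_fourth hx hR) (sq_nonneg σ))
  -- Here ‖⟨v, x⟩ x‖² = ⟨v, ‖x‖ x⟩², so the fourth-moment condition applies directly.
  have hb : ∀ v : Vec d, ∫ ω, ‖(inner ℝ v (x ω) : ℝ) • x ω‖ ^ 2 ∂P
      ≤ R ^ 2 * mahalSq (secondMoment P x) v := by
    intro v
    refine le_trans (le_of_eq ?_) (mahalSq_le_of_posSemidef hR v)
    rw [mahalSq_secondMoment hw]
    congr 1
    funext ω
    rw [norm_smul, mul_pow, Real.norm_eq_abs, sq_abs, inner_smul_right]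
    ring
  refine (integral_noise_le hx hy hξ2 hc (ContinuousLinearMap.id ℝ (Vec d)) ha hb p s).trans
    (le_of_eq ?_)
  ring

/-- Bound on the whitened norm of the gradient noise. -/
lemma integral_norm_whitened_gradNoise_le [IsProbabilityMeasure P] {x : Ω → Vec d} {y : Ω → ℝ}
    (hx : MemLp x 4 P) (hy : MemLp y 2 P) (hξ2 : MemLp (lsResidual x y c) 2 P)
    (hc : ∀ θ, lsRisk P x y c ≤ lsRisk P x y θ) (hS : (secondMoment P x).PosDef) {σ κ : ℝ}
    (hξ : (σ ^ 2 • secondMoment P x - secondMoment P (lsResidual x y c)).PosSemidef)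
    (hkurt_int : ∀ z : Vec d, Integrable (fun ω => (inner ℝ z (x ω)) ^ 4) P)
    (hkurt : ∀ z : Vec d, ∫ ω, (inner ℝ z (x ω)) ^ 4 ∂P
      ≤ κ * mahalSq (secondMoment P x) z ^ 2)
    {B : Vec d →L[ℝ] Vec d} {b : Fin d → Vec d} (hb : ∀ i, mahalSq (secondMoment P x) (b i) = 1)
    (hB : ∀ u i, B u i = inner ℝ (b i) u) (p s : Vec d) :
    ∫ ω, ‖B (gradNoise (secondMoment P x) c s (x ω, y ω))‖ ^ 2 ∂P
      ≤ 3 * (σ ^ 2 * d + κ * d * mahalSq (secondMoment P x) (p - c))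
        + 3 * κ * d * mahalSq (secondMoment P x) (s - p) := by
  -- The dimension enters here: the whitened norm is a sum of d squares, each in a direction of unit
  -- S-norm.
  have hBn : ∀ u, ‖B u‖ ^ 2 = ∑ i, (inner ℝ (b i) u) ^ 2 := by
    intro u
    rw [EuclideanSpace.real_norm_sq_eq]
    simp_rw [hB]
  have ha : ∫ ω, ‖B (lsResidual x y c ω)‖ ^ 2 ∂P ≤ σ ^ 2 * d := by
    simp_rw [hBn]
    rw [integral_finsetSum _ fun i _ => (hξ2.const_inner (b i)).integrable_sq]
    refine (Finset.sum_le_card_nsmul Finset.univ _ (σ ^ 2) fun i _ => ?_).trans (le_of_eq ?_)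
    · rw [← mahalSq_secondMoment hξ2]
      simpa [hb i] using mahalSq_le_of_posSemidef hξ (b i)
    · simp [mul_comm]
  have hv : ∀ v : Vec d, ∫ ω, ‖B ((inner ℝ v (x ω) : ℝ) • x ω)‖ ^ 2 ∂P
      ≤ κ * d * mahalSq (secondMoment P x) v := by
    intro v
    simp_rw [hBn, inner_smul_right, mul_pow]
    rw [integral_finsetSum _ fun i _ => integrable_inner_sq_mul_inner_sq hx v (b i)]
    refine (Finset.sum_le_card_nsmul Finset.univ _ (κ * mahalSq (secondMoment P x) v)
      fun i _ => ?_).trans (le_of_eq ?_)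
    · exact integral_inner_sq_mul_inner_sq_le hx hS hkurt_int hkurt v (b i) (hb i)
    · simp only [Finset.card_univ, Fintype.card_fin, nsmul_eq_mul]
      ring
  refine (integral_noise_le hx hy hξ2 hc B ha hv p s).trans (le_of_eq ?_)
  ring

/-- With η₀ = ∇h(θ₀) the initial gap is the Bregman divergence. -/
lemma bregman_eq_coe (hh : IsProperLscConvex h) (g : Vec d → EReal) (γ : ℝ) {θ₀ : Vec d}
    (hp : p ∈ effDom h) (hθ₀ : θ₀ ∈ effDom h) :
    bregman h p θ₀ = (dualGap (stageFun h g γ 0) p (egrad h θ₀) θ₀ : ℝ) := by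
  rw [bregman, ← hh.coe_toReal hp, ← hh.coe_toReal hθ₀, ← EReal.coe_sub, ← EReal.coe_sub,
    EReal.coe_eq_coe_iff, dualGap, inner_sub_right]
  simp only [stageFun, Nat.cast_zero, zero_mul, add_zero]
  ring

lemma bregman_eq_top (hh : IsProperLscConvex h) {θ₀ : Vec d}
    (hp : p ∉ effDom h) (hθ₀ : θ₀ ∈ effDom h) : bregman h p θ₀ = ⊤ := by
  have : h p = ⊤ := not_not.1 hp
  rw [bregman, this, ← hh.coe_toReal hθ₀, EReal.top_sub_coe, EReal.top_sub_coe]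

/-- Put r = γκR²/μ ≤ 1/4. The coefficient of n W0 is 3 + 12r ≤ 6 + 8r since 4r ≤ 1, where κ ≥ 1
gives dd(σ² + B0) ≤ W0. The initial terms add up to (5/2)D/γ, so κ dd D/γ has coefficient 15/2 ≤ 20;
the term in G0 only enlarges the right-hand side. -/
lemma final_bound_le {dd n D W0 B0 A0 G0 σ κ R : ℝ} (hn : 0 < n) (hμ : 0 < μ) (hγ : 0 < γ)
    (hκ : 1 ≤ κ) (hd : 0 ≤ dd) (hB0 : 0 ≤ B0) (hD : 0 ≤ D) (hG0 : 0 ≤ G0)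
    (hγR : γ * κ * R ^ 2 / μ ≤ 1 / 4) (hA0 : A0 ≤ D / (2 * γ))
    (hW : W0 = σ ^ 2 * dd + κ * dd * B0) :
    2 * D / (γ * n) + 4 / n ^ 2 * (n * (3 * W0) + 3 * κ * dd * (A0 + 2 * D / γ
        + n * (4 / 3 * γ / μ * (3 * R ^ 2 * (σ ^ 2 + B0)))))
      ≤ 2 / (γ * n) * D + 8 / n * (3 + 4 * γ * κ * R ^ 2 / μ) * W0
        + 16 * κ * dd / n ^ 2 * (5 / γ * D + G0) := by
  set r := γ * κ * R ^ 2 / μ with hr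
  have hr0 : 0 ≤ r := by positivity
  have hW0 : 0 ≤ W0 := by rw [hW]; positivity
  have h1 : dd * (σ ^ 2 + B0) ≤ W0 := by
    rw [hW]
    have : 0 ≤ dd * B0 := by positivity
    nlinarith
  have e1 : 3 * κ * dd * (n * (4 / 3 * γ / μ * (3 * R ^ 2 * (σ ^ 2 + B0))))
      = 12 * n * r * (dd * (σ ^ 2 + B0)) := by
    rw [hr]; field_simp; ring
  have e2 : 4 * γ * κ * R ^ 2 / μ = 4 * r := by rw [hr]; ring
  have h2 : 12 * n * r * (dd * (σ ^ 2 + B0)) ≤ 12 * n * r * W0 := by gcongr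
  have h3 : A0 + 2 * D / γ ≤ 5 / 2 * D / γ := by
    have : D / (2 * γ) + 2 * D / γ = 5 / 2 * D / γ := by field_simp; ring
    linarith
  have h4 : n * (3 * W0) + 3 * κ * dd * (A0 + 2 * D / γ
        + n * (4 / 3 * γ / μ * (3 * R ^ 2 * (σ ^ 2 + B0))))
      ≤ n * (3 * W0) + 3 * κ * dd * (5 / 2 * D / γ) + 12 * n * r * W0 := by
    rw [mul_add (3 * κ * dd), e1]
    have : 3 * κ * dd * (A0 + 2 * D / γ) ≤ 3 * κ * dd * (5 / 2 * D / γ) := by gcongr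
    linarith
  have h5 : n * r * W0 ≤ n * (1 / 4) * W0 := by gcongr
  have h6 : 0 ≤ κ * dd * (D / γ) := by positivity
  have h7 : 0 ≤ κ * dd * G0 := by positivity
  have h8 : 0 ≤ n * W0 := by positivity
  rw [e2]
  have e3 : 2 / (γ * n) * D = 2 * D / (γ * n) := by ring
  have e4 : 8 / n * (3 + 4 * r) * W0 = 4 / n ^ 2 * (n * W0 * (6 + 8 * r)) := by
    field_simp; ring
  have e5 : 16 * κ * dd / n ^ 2 * (5 / γ * D + G0)
      = 4 / n ^ 2 * (20 * (κ * dd * (D / γ)) + 4 * (κ * dd * G0)) := by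
    field_simp
    ring
  have e6 : 3 * κ * dd * (5 / 2 * D / γ) = 15 / 2 * (κ * dd * (D / γ)) := by ring
  have h9 : n * (3 * W0) + 3 * κ * dd * (5 / 2 * D / γ) + 12 * n * r * W0
      ≤ n * W0 * (6 + 8 * r) + (20 * (κ * dd * (D / γ)) + 4 * (κ * dd * G0)) := by
    rw [e6]
    linarith
  have h10 := mul_le_mul_of_nonneg_left (h4.trans h9) (show 0 ≤ 4 / n ^ 2 by positivity)
  rw [e3, e4, e5]
  linarith

end Assembly

end DualAveraging

theorem mainTheorem10 {Ω : Type*} [MeasurableSpace Ω] (P : Measure Ω) [IsProbabilityMeasure P]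
    (d : ℕ)
    -- the regularizer, the mirror map and the constraint set
    (h g : Vec d → EReal) (X : Set (Vec d))
    (hg : IsProperLscConvex g) (hh : IsLegendre h)
    (hX : closure (effDom h) ∩ closure (effDom g) = X) (hXint : (interior X).Nonempty)
    (hdom : (interior (effDom h) ∩ effDom g).Nonempty)
    (hg_nonneg : ∀ θ, 0 ≤ g θ)
    -- strong convexity of the mirror map with respect to the Euclidean norm
    (μh : ℝ) (hμh : 0 < μh)
    (hstrong : ConvexOn ℝ (effDom h) (fun θ => (h θ).toReal - μh / 2 * ‖θ‖ ^ 2))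
    -- i.i.d. observations with finite variances; index `n` stores observation number `n + 1`
    (x : ℕ → Ω → Vec d) (y : ℕ → Ω → ℝ)
    (hx : ∀ n, Measurable (x n)) (hy : ∀ n, Measurable (y n))
    (hindep : iIndepFun (fun n ω => (x n ω, y n ω)) P)
    (hident : ∀ n, IdentDistrib (fun ω => (x n ω, y n ω)) (fun ω => (x 0 ω, y 0 ω)) P P)
    (hx2 : MemLp (x 0) 2 P) (hy2 : MemLp (y 0) 2 P)
    -- the population covariance matrix, which is invertible
    (S : Matrix (Fin d) (Fin d) ℝ) (hS : S = secondMoment P (x 0)) (hSpos : S.PosDef)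
    -- the global minimizer of the risk, and a minimizer of the composite objective
    (θS : Vec d) (hθS : ∀ θ, lsRisk P (x 0) (y 0) θS ≤ lsRisk P (x 0) (y 0) θ)
    (θopt : Vec d) (hθoptX : θopt ∈ X)
    (hθopt : ∀ θ ∈ X, ((lsRisk P (x 0) (y 0) θopt : ℝ) : EReal) + g θopt
      ≤ ((lsRisk P (x 0) (y 0) θ : ℝ) : EReal) + g θ)
    -- noise, kurtosis and fourth moment conditions
    (σ : ℝ) (hσ : 0 < σ) (hξ2 : MemLp (lsResidual (x 0) (y 0) θS) 2 P)
    (hξ : (σ ^ 2 • S - secondMoment P (lsResidual (x 0) (y 0) θS)).PosSemidef)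
    (κ : ℝ) (hκ : 0 < κ)
    (hkurt_int : ∀ z : Vec d, Integrable (fun ω => (inner ℝ z (x 0 ω)) ^ 4) P)
    (hkurt : ∀ z : Vec d, ∫ ω, (inner ℝ z (x 0 ω)) ^ 4 ∂P ≤ κ * mahalSq S z ^ 2)
    (R : ℝ) (hR : (R ^ 2 • S - secondMoment P (fun ω => ‖x 0 ω‖ • x 0 ω)).PosSemidef)
    -- starting point and step-size
    (θ₀ : Vec d) (hθ₀ : θ₀ ∈ interior (effDom h))
    (γ : ℝ) (hγ : 0 < γ) (hγle : γ ≤ min (μh / (4 * κ * R ^ 2)) (R ^ 2 / (4 * κ * d)))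
    (n : ℕ) (hn : 1 ≤ n) :
    Integrable (fun ω => mahalSq S
        (sdaAverage h g γ θ₀ (fun k => x k ω) (fun k => y k ω) n - θopt)) P ∧
    ((1 / 2 * ∫ ω, mahalSq S
        (sdaAverage h g γ θ₀ (fun k => x k ω) (fun k => y k ω) n - θopt) ∂P : ℝ) : EReal)
      ≤ ((2 / (γ * n) : ℝ) : EReal) * bregman h θopt θ₀
        + ((8 / n * (3 + 4 * γ * κ * R ^ 2 / μh)
            * (σ ^ 2 * d + κ * d * mahalSq S (θopt - θS)) : ℝ) : EReal)
        + ((16 * κ * d / (n : ℝ) ^ 2 : ℝ) : EReal)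
            * (((5 / γ : ℝ) : EReal) * bregman h θopt θ₀ + g θ₀) := by
  subst hS hX
  have hx4 : MemLp (x 0) 4 P := memLp_four_of_inner (hx 0).aestronglyMeasurable hkurt_int
  set S := secondMoment P (x 0) with hSdef
  set θ : ℕ → Ω → Vec d := fun k ω => (sda h g γ θ₀ (fun k => x k ω) (fun k => y k ω) k).2
  obtain ⟨hγ1, hγ2⟩ := le_min_iff.1 hγle
  -- Division by zero gives zero, so d = 0 or R = 0 would make a step-size bound vanish and
  -- contradict γ > 0.
  have hd : 0 < d := by
    rcases Nat.eq_zero_or_pos d with h0 | h0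
    · rw [h0, Nat.cast_zero, mul_zero, div_zero] at hγ2
      linarith
    · exact h0
  have hR2 : 0 < R ^ 2 := by
    rcases (sq_nonneg R).eq_or_lt with h0 | h0
    · rw [← h0, mul_zero, div_zero] at hγ1
      linarith
    · exact h0
  have hn0 : (0 : ℝ) < n := by exact_mod_cast hn
  have hd0 : (0 : ℝ) < d := by exact_mod_cast hd
  have hZ := isNoiseModel_of_iid hx hy hindep hident hx4 hy2 hξ2 hθS
  have hab := integral_norm_gradNoise_le hx4 hy2 hξ2 hθS hξ hR θopt
  have hD := isDualPath_sda hh hg hg_nonneg hdom hμh hγ hstrong hθ₀ hZ hab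
  have hSnn : ∀ v, 0 ≤ mahalSq S v := mahalSq_nonneg hSpos.posSemidef
  have hθ₀h : θ₀ ∈ effDom h := interior_subset hθ₀
  refine ⟨integrable_mahalSq S (v := fun ω => sdaAverage h g γ θ₀ (fun k => x k ω)
    (fun k => y k ω) n - θopt) ?_, ?_⟩
  · have hsum : MemLp (fun ω => ∑ k ∈ Finset.range n, θ k ω) 2 P :=
      memLp_finsetSum _ fun k _ => hD.memLp k
    exact (hsum.const_smul (n : ℝ)⁻¹).sub (memLp_const θopt)
  have hc1 : (0 : ℝ) < 2 / (γ * n) := by positivity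
  have hc3 : (0 : ℝ) < 16 * κ * d / (n : ℝ) ^ 2 := by positivity
  have hc5 : (0 : ℝ) < 5 / γ := by positivity
  -- The minimizer may lie on the boundary outside the domain of h. An infinite divergence or an
  -- infinite g θ₀ makes the right-hand side ⊤, since the coefficients are positive; otherwise all
  -- terms are real.
  by_cases hph : θopt ∈ effDom h
  swap
  · rw [bregman_eq_top hh.proper hph hθ₀h, EReal.coe_mul_top_of_pos hc1,
      EReal.coe_mul_top_of_pos hc5, EReal.top_add_of_ne_bot (hg.ne_bot θ₀),
      EReal.coe_mul_top_of_pos hc3, EReal.top_add_coe, EReal.top_add_top]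
    exact le_top
  rw [bregman_eq_coe hh.proper g γ hph hθ₀h]
  set D := dualGap (stageFun h g γ 0) θopt (egrad h θ₀) θ₀ with hDdef
  by_cases hg₀ : θ₀ ∈ effDom g
  swap
  · have : g θ₀ = ⊤ := not_not.1 hg₀
    rw [this, ← EReal.coe_mul, ← EReal.coe_mul, EReal.coe_add_top, EReal.coe_mul_top_of_pos hc3,
      ← EReal.coe_add, EReal.coe_add_top]
    exact le_top
  rw [← hg.coe_toReal hg₀]
  norm_cast
  -- first order optimality of the minimizer
  have hexp := fun p z => lsRisk_expansion hx4 hy2 hξ2 p z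
  have hpg : θopt ∈ effDom g := by
    obtain ⟨z, hz1, hz2⟩ := hdom
    have h1 := hθopt z ⟨subset_closure (interior_subset hz1), subset_closure hz2⟩
    intro htop
    rw [htop, EReal.coe_add_top, top_le_iff, ← hg.coe_toReal hz2, ← EReal.coe_add] at h1
    exact EReal.coe_ne_top _ h1
  have hopt : ∀ z ∈ effDom h ∩ effDom g, 0 ≤ inner ℝ (Matrix.toEuclideanLin S (θopt - θS))
      (z - θopt) + (g z).toReal - (g θopt).toReal := by
    intro z hz
    refine hg.first_order (hh.proper.convexOn.1.closure.inter hg.convexOn.1.closure)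
      (f := lsRisk P (x 0) (y 0)) (q := mahalSq S) (mahalSq_smul S) (fun z => ?_) hθoptX hpg hθopt
      ⟨subset_closure hz.1, subset_closure hz.2⟩ hz.2
    rw [hexp θopt z, integral_lsGrad hx4 hy2 hξ2 hθS]
  -- constants
  obtain ⟨B, b, hB, hb, hBb⟩ := exists_whitening hSpos
  -- This bound turns the step-size condition into γR² ≤ μh/4, and hence γS ≤ μh/4, since the trace
  -- of S is at most R².
  have hκ1 : 1 ≤ κ := one_le_kurtosis hx4 hkurt_int hkurt (hb ⟨0, hd⟩)
  have hab' := integral_norm_whitened_gradNoise_le hx4 hy2 hξ2 hθS hSpos hξ hkurt_int hkurt hb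
    hBb θopt
  have hγR : γ * (κ * R ^ 2) ≤ μh / 4 := by
    rw [le_div_iff₀ (by positivity)] at hγ1
    linarith
  have hγR1 : γ * R ^ 2 ≤ μh / 4 := by
    have : γ * (1 * R ^ 2) ≤ γ * (κ * R ^ 2) := by gcongr
    linarith
  have hSR : ∀ v, mahalSq S v ≤ R ^ 2 * ‖v‖ ^ 2 := fun v =>
    (mahalSq_secondMoment_le hx2 v).trans
      (mul_le_mul_of_nonneg_right (integral_norm_sq_le_of_fourth hx4 hR) (by positivity))
  have hLμ : ∀ v, γ * mahalSq S v ≤ μh / 4 * ‖v‖ ^ 2 := fun v => by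
    have h1 := mul_le_mul_of_nonneg_left (hSR v) hγ.le
    have h2 := mul_le_mul_of_nonneg_right hγR1 (sq_nonneg ‖v‖)
    linarith
  have hL : (Matrix.toEuclideanLin S).IsSymmetric :=
    Matrix.isSymmetric_toEuclideanLin_iff.2 hSpos.isHermitian
  have hmin0 := isStrongMin_stage_zero hh hstrong g γ hθ₀
  obtain ⟨ν, φ, hν0, hφ0, hν, hφ⟩ := exists_noiseFree_run
    (T := fun k η => egrad (conj (mirrorReg h g γ (k + 1))) η)
    (isStrongMin_egrad_conj hh hg hg_nonneg hdom hμh hγ hstrong) hmin0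
    (fun z => Matrix.toEuclideanLin S (z - θS))
  have hD0 : 0 ≤ D := hmin0.dualGap_nonneg hμh.le hph
  -- The initial error is charged to D: γ‖θ₀ - p‖_S² ≤ μh/4‖θ₀ - p‖², while the growth of h at θ₀
  -- gives μh/2‖θ₀ - p‖² ≤ D.
  have hA0 : mahalSq S (φ 0 - θopt) ≤ D / (2 * γ) := by
    have h1 := hmin0.le θopt hph
    have h2 : μh / 2 * ‖θopt - θ₀‖ ^ 2 ≤ D := by
      rw [hDdef, dualGap]
      linarith
    have h3 := hLμ (θ₀ - θopt)
    rw [norm_sub_rev] at h3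
    rw [hφ0, le_div_iff₀ (by positivity)]
    linarith
  have hmain := hD.half_integral_mahalSq_average_le hZ hμh hγ hL hSnn hLμ ⟨hph, hpg⟩ hopt
    -- With b = 3R² the absorption condition on the noise reduces to γR² ≤ μh/4.
    (by positivity) hab (by
      have : 2 / 3 * γ ^ 2 / μh * (3 * R ^ 2) = 2 * γ / μh * (γ * R ^ 2) := by
        field_simp
      rw [this]
      calc 2 * γ / μh * (γ * R ^ 2) ≤ 2 * γ / μh * (μh / 4) := by gcongr
        _ = γ / 2 := by field_simp; norm_num)
    hB hab' hφ hν (fun ω => hν0.symm) (fun ω => hφ0.symm)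
    (D := D) (by rw [hν0, hφ0]) hn
  refine hmain.trans ?_
  refine (final_bound_le hn0 hμh hγ hκ1 hd0.le (hSnn (θopt - θS)) hD0
    (EReal.toReal_nonneg (hg_nonneg θ₀)) ?_ hA0 rfl).trans (le_of_eq ?_)
  · rw [div_le_iff₀ hμh]
    linarith
  · push_cast
    ring
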